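/- **Setting.** Let $p=d_{\mathrm{disc}}\ge 0$, $q=d_{\mathrm{cont}}$, $\tau\in\{1,\dots,q\}$, $T\ge 0$, $N\ge 1$. Paths take values in $\mathbb R^{d_X}$, $d_X=2p+q$, with $p$ value coordinates, then $p$ count coordinates, then $q$ continuous coordinates. $T^N(\mathbb R^{d_X})$ is the truncated tensor algebra with product $(\mathbf a\otimes\mathbf b)^I=\sum_{I=JK}\mathbf a^J\mathbf b^K$, $\mathfrak L^N(\mathbb R^{d_X})$ its Lie subalgebra generated by the degree-one tensors, $\exp,\log$ the truncated tensor exponential and logarithm, and $S^N_{s,t}(X)$ the truncated signature of a continuous bounded-variation path $X$, $S_{s,t}(X)^{i_1\cdots i_k}=\int_{s<u_1<\cdots<u_k<t}dX^{i_1}_{u_1}\cdots dX^{i_k}_{u_k}$. *Inputs.* $\mathcal C^\tau_{BV}$ is the space of continuous bounded-variation paths $C:[0,T]\to\mathbb R^q$ with $C^\tau_t=t$, with the uniform topology. For each non-empty $s\subseteq\{1,\dots,p\}$ let $O_s$ be a topological space of local records. For an event pattern $\sigma=(s_0,\dots,s_{m-1})$, $m\ge0$, of non-empty sets, $\mathcal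 X_\sigma$ is the space of $((t_i)_{i<m},(o_i)_{i<m})$ with $0\le t_0<\cdots<t_{m-1}\le T$ and $o_i\in O_{s_i}$, with the product topology; $\mathcal X=\coprod_\sigma\mathcal X_\sigma$ and $\mathcal D=\mathcal C^\tau_{BV}\times\mathcal X$. *Local-factor assumptions.* For each $s$ there are a continuous injective map $\iota_s:O_s\to\mathfrak L^N(\mathbb R^{d_X})$ and a continuous map $\eta_s$ from $O_s$ into the continuous bounded-variation paths $[0,1]\to\mathbb R^{d_X}$ (uniform topology) such that: $\iota_s(o)$ and $\eta_s(o)$ use only the first $2p$ coordinates; the degree-one count coordinates are $\pi_1(\iota_s(o))^{p+k}=\mathbf 1_{\{k\in s\}}$; $\eta_s(o)(0)=0$; and $S^N_{0,1}(\eta_s(o))=\exp(\iota_s(o))$. *Path realisation.* Let $I_m=[0,T+m+1]$, $\mathcal P=\coprod_{m\ge0}C(I_m,\mathbb R^{d_X})$ (disjoint-union topology, uniform topology on each component), and $\widetilde C$ be $C$ placed in the last $q$ coordinates. For $(C,x)\in\mathcal D$ with $m$ events put $\rho_*(u)=\min\{1,\max\{0,u\}\}$, $\rho_i(u)=\min\{1,\max\{0,u-1-t_i-i\}\}$,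 $q_x(u)=u-\rho_*(u)-\sum_{i<m}\rho_i(u)$ and, for $u\in I_m$, $$\Psi(x,C)(u)=\rho_*(u)\widetilde C_0+\bigl(\widetilde C(q_x(u))-\widetilde C_0\bigr)+\sum_{i<m}\eta_{s_i}(o_i)(\rho_i(u)).$$ For $\Psi=\Psi(x,C)$ let $a_\Psi(t)=\inf\{u\in I_m:\Psi^{2p+\tau}(u)=t\}$, $b_\Psi(\beta)=a_\Psi(\beta)$ for $\beta<T$, $b_\Psi(T)=T+m+1$, and let $S^N_{\alpha,\beta}(\Psi):=S^N_{a_\Psi(\alpha),b_\Psi(\beta)}(\Psi)$ be the signature over the physical-time interval $[\alpha,\beta)$. *Interval summary.* Let $\Gamma_{u,v}=S^N_{u,v}(\widetilde C)$, $E_i=\exp(\iota_{s_i}(o_i))$, $B_C=\exp(\widetilde C_0)$, and let $i_1<\cdots<i_r$ be the events with $\alpha\le t_i<\beta$ (with events at $T$ included if $\beta=T$). Put $\Phi_{\alpha,\beta}(x,C)=\log G_{\alpha,\beta}(x,C)$, where $$G_{\alpha,\beta}(x,C)=B\otimes\Gamma_{\alpha,t_{i_1}}\otimes E_{i_1}\otimes\Gamma_{t_{i_1},t_{i_2}}\otimes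 E_{i_2}\otimes\cdots\otimes E_{i_r}\otimes\Gamma_{t_{i_r},\beta},$$ with $B=B_C$ if $\alpha=0$ and $B=\mathbf 1$ if $\alpha>0$ (and $G_{\alpha,\beta}=B\otimes\Gamma_{\alpha,\beta}$ if $r=0$). **Proposition (Formal faithfulness).** (a) Under the local-factor assumptions, the map $(C,x)\mapsto\Psi(x,C)$ from $\mathcal D$ to $\mathcal P$ is continuous and injective. Every $\Psi(x,C)$ has bounded variation, and for all $0\le\alpha<\beta\le T$, $$\log S^N_{\alpha,\beta}(\Psi(x,C))=\Phi_{\alpha,\beta}(x,C).$$ (b) The same conclusions hold for the default construction on raw streams, where the record at event $i$ consists of the observed values $x_i^k\in\mathbb R$, $k\in s_i$: the event element is the degree-one tensor $\Delta_i=\sum_{k\in s_i}\bigl[(x_i^k-x^k_{\mathrm{prev}(i,k)})e_k+e_{p+k}\bigr]$, where $\mathrm{prev}(i,k)$ is the last event before $i$ at which channel $k$ is observed (the value being $0$ if there is none), and the event path is $u\mapsto u\Delta_i$. That is, the resulting map $(C,x)\mapsto\Psi(x,C)$ is continuous and injective as a function of $C$ and of the raw stream $x$, every $\Psi(x,C)$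 has bounded variation, and the interval identity holds. -/

import Mathlib

open Set MeasureTheory

noncomputable section

namespace StreamEmbedding

/-! ### The truncated tensor algebra, in coordinates indexed by words -/

/-- Words of length at most `N` in the alphabet `A`. -/
abbrev Word (A : Type*) (N : ℕ) : Type _ := {w : List A // w.length ≤ N}

/-- The depth-`N` truncated tensor algebra over `ℝ^A`: an element is given by its coordinates `a^w`
for the words `w` of length at most `N`. -/
def TruncTensor (A : Type*) (N : ℕ) : Type _ := Word A N → ℝ

namespace TruncTensor

variable {A : Type*} {N : ℕ}

instance : AddCommGroup (TruncTensor A N) := inferInstanceAs (AddCommGroup (Word A N → ℝ))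

instance : Module ℝ (TruncTensor A N) := inferInstanceAs (Module ℝ (Word A N → ℝ))

instance : TopologicalSpace (TruncTensor A N) := inferInstanceAs (TopologicalSpace (Word A N → ℝ))

/-- The initial part of length `k` of a word. -/
def take (k : ℕ) (w : Word A N) : Word A N :=
  ⟨w.1.take k, (List.length_take_le' k w.1).trans w.2⟩

/-- What remains of a word after its first `k` letters. -/
def drop (k : ℕ) (w : Word A N) : Word A N :=
  ⟨w.1.drop k, (by simp : (w.1.drop k).length ≤ w.1.length).trans w.2⟩

/-- The truncated tensor product, `(a ⊗ b)^w = ∑_{w = uv} a^u b^v`. -/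
instance : Mul (TruncTensor A N) where
  mul a b := fun w => ∑ k ∈ Finset.range (w.1.length + 1), a (take k w) * b (drop k w)

/-- The unit: `1` on the empty word, `0` on every other word. -/
instance : One (TruncTensor A N) where
  one := fun w => if w.1 = [] then 1 else 0

theorem ext' {a b : TruncTensor A N} (h : ∀ w, a w = b w) : a = b := funext h

theorem add_apply (a b : TruncTensor A N) (w : Word A N) : (a + b) w = a w + b w := rfl

theorem zero_apply (w : Word A N) : (0 : TruncTensor A N) w = 0 := rfl

theorem smul_apply (r : ℝ) (a : TruncTensor A N) (w : Word A N) : (r • a) w = r * a w := rfl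

theorem mul_apply (a b : TruncTensor A N) (w : Word A N) :
    (a * b) w = ∑ k ∈ Finset.range (w.1.length + 1), a (take k w) * b (drop k w) := rfl

theorem one_apply (w : Word A N) :
    (1 : TruncTensor A N) w = if w.1 = [] then 1 else 0 := rfl

protected theorem one_mul (a : TruncTensor A N) : 1 * a = a := by
  refine ext' fun w => ?_
  rw [mul_apply, Finset.sum_eq_single 0]
  · have h1 : (1 : TruncTensor A N) (take 0 w) = 1 := by simp [one_apply, take]
    have h2 : drop 0 w = w := by simp [drop]
    rw [h1, h2, one_mul]
  · intro k hk hk0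
    have h1 : (1 : TruncTensor A N) (take k w) = 0 := by
      rw [one_apply, if_neg]
      intro h
      have := congrArg List.length h
      simp [take] at this
      rcases this with h | h
      · exact hk0 h
      · simp [h] at hk
        exact hk0 hk
    rw [h1, zero_mul]
  · intro h
    simp at h

protected theorem mul_one (a : TruncTensor A N) : a * 1 = a := by
  refine ext' fun w => ?_
  rw [mul_apply, Finset.sum_eq_single w.1.length]
  · have h1 : (1 : TruncTensor A N) (drop w.1.length w) = 1 := by simp [one_apply, drop]
    have h2 : take w.1.length w = w := by simp [take]
    rw [h1, h2, mul_one]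
  · intro k hk hk0
    have h1 : (1 : TruncTensor A N) (drop k w) = 0 := by
      rw [one_apply, if_neg]
      intro h
      have := congrArg List.length h
      simp [drop] at this hk
      omega
    rw [h1, mul_zero]
  · intro h
    simp at h

protected theorem mul_assoc (a b c : TruncTensor A N) : a * b * c = a * (b * c) := by
  refine ext' fun w => ?_
  simp only [mul_apply, Finset.sum_mul, Finset.mul_sum]
  rw [Finset.sum_sigma', Finset.sum_sigma']
  refine Finset.sum_bij' (fun x _ => ⟨x.2, x.1 - x.2⟩) (fun x _ => ⟨x.1 + x.2, x.1⟩)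
    ?_ ?_ ?_ ?_ ?_
  · rintro ⟨k, j⟩ h
    simp [take, drop] at h ⊢
    omega
  · rintro ⟨k, j⟩ h
    simp [take, drop] at h ⊢
    omega
  · rintro ⟨k, j⟩ h
    simp [take] at h ⊢
    omega
  · rintro ⟨k, j⟩ h
    simp
  · rintro ⟨k, j⟩ h
    simp [take] at h
    have hjk : j ≤ k := by omega
    have h1 : take j (take k w) = take j w := by
      simp [take, List.take_take, hjk]
    have h2 : drop j (take k w) = take (k - j) (drop j w) := by
      simp [take, drop, List.drop_take]
    have h3 : drop (k - j) (drop j w) = drop k w := by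
      simp [drop, hjk]
    simp only [h1, h2, h3, mul_assoc]

instance : Ring (TruncTensor A N) where
  __ := (inferInstance : AddCommGroup (TruncTensor A N))
  mul := (· * ·)
  one := 1
  mul_assoc := TruncTensor.mul_assoc
  one_mul := TruncTensor.one_mul
  mul_one := TruncTensor.mul_one
  zero_mul a := ext' fun w => by simp [mul_apply, zero_apply]
  mul_zero a := ext' fun w => by simp [mul_apply, zero_apply]
  left_distrib a b c := ext' fun w => by
    simp [mul_apply, add_apply, mul_add, Finset.sum_add_distrib]
  right_distrib a b c := ext' fun w => by
    simp [mul_apply, add_apply, add_mul, Finset.sum_add_distrib]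

instance : Algebra ℝ (TruncTensor A N) :=
  Algebra.ofModule
    (fun r a b => ext' fun w => by
      simp [mul_apply, smul_apply, Finset.mul_sum, mul_assoc])
    (fun r a b => ext' fun w => by
      simp [mul_apply, smul_apply, Finset.mul_sum, mul_left_comm])

/-- The Lie bracket `[a, b] = a ⊗ b - b ⊗ a`. -/
instance : LieRing (TruncTensor A N) := LieRing.ofAssociativeRing

/-- The degree-one tensor with the coordinates of the vector `v`. -/
def ofVec (v : A → ℝ) : TruncTensor A N := fun w =>
  match w.1 with
  | [i] => v i
  | _ => 0

/-- The tensor exponential `∑ aⁿ / n!`. For `a` without a degree-zero part, the only case in which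
it is used, the powers beyond `N` vanish in the truncated algebra. -/
def exp (a : TruncTensor A N) : TruncTensor A N :=
  ∑ n ∈ Finset.range (N + 1), (n.factorial : ℝ)⁻¹ • a ^ n

/-- The tensor logarithm `∑_{m ≥ 1} (-1)^{m+1} / m (g - 1)^m`. For `g` with degree-zero part `1`, the
only case in which it is used, the powers beyond `N` vanish in the truncated algebra. -/
def log (g : TruncTensor A N) : TruncTensor A N :=
  ∑ m ∈ Finset.Icc 1 N, ((-1 : ℝ) ^ (m + 1) / m) • (g - 1) ^ m

end TruncTensor

/-- The truncated free Lie algebra: the Lie subalgebra (for the commutator bracket) of the truncated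
tensor algebra that is generated by the degree-one tensors. -/
abbrev TruncLie (A : Type*) (N : ℕ) : LieSubalgebra ℝ (TruncTensor A N) :=
  LieSubalgebra.lieSpan ℝ (TruncTensor A N) (range TruncTensor.ofVec)

/-! ### Signatures of continuous paths of bounded variation -/

open Classical in
/-- The Stieltjes measure `df` on the line of a function `f` of bounded variation. -/
def stieltjes (f : ℝ → ℝ) : SignedMeasure ℝ :=
  if h : BoundedVariationOn f univ then h.vectorMeasure else 0

/-- The iterated integral `∫_{s < u₁ < ⋯ < u_k < t} dX^{i₁}_{u₁} ⋯ dX^{i_k}_{u_k}` for the word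
`i₁ ⋯ i_k`, by integrating over `u₁` the iterated integral over `u₁ < u₂ < ⋯ < u_k < t`. -/
def iteratedIntegral {A : Type*} (X : ℝ → A → ℝ) : List A → ℝ → ℝ → ℝ
  | [], _, _ => 1
  | i :: w, s, t => ∫ᵛ u in Ioc s t, iteratedIntegral X w u t ∂• stieltjes (fun v => X v i)

/-- The truncated signature over `[s, t]` of a path on the line. -/
def signature {A : Type*} (N : ℕ) (X : ℝ → A → ℝ) (s t : ℝ) : TruncTensor A N :=
  fun w => iteratedIntegral X w.1 s t

/-- A path on `[a, b]`, continued to the line by its end values. -/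
abbrev extend {A : Type*} {a b : ℝ} (h : a ≤ b) (X : C(Icc a b, A → ℝ)) : ℝ → A → ℝ :=
  IccExtend h X

/-! ### The input space -/

/-- The coordinates of the path space: `p` value coordinates, then `p` count coordinates, then `q`
coordinates for the continuously observed variables. -/
abbrev Coord (p q : ℕ) : Type := Fin p ⊕ Fin p ⊕ Fin q

/-- The value coordinate of channel `k`. -/
abbrev Coord.value {p : ℕ} (q : ℕ) (k : Fin p) : Coord p q := Sum.inl k

/-- The count coordinate of channel `k`. -/
abbrev Coord.count {p : ℕ} (q : ℕ) (k : Fin p) : Coord p q := Sum.inr (Sum.inl k)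

/-- The coordinate of the continuous channel `j`. -/
abbrev Coord.cont (p : ℕ) {q : ℕ} (j : Fin q) : Coord p q := Sum.inr (Sum.inr j)

/-- Continuous paths of bounded variation `[0, T] → ℝ^q` whose channel `τ` is physical time; as a
subspace of `C([0, T], ℝ^q)` it carries the uniform topology. -/
abbrev ContPath (q : ℕ) (T : ℝ) (τ : Fin q) : Type :=
  {C : C(Icc (0 : ℝ) T, Fin q → ℝ) // BoundedVariationOn C univ ∧ ∀ t, C t τ = t}

/-- The non-empty sets of channels that can be observed at an event. -/
abbrev ObsSet (p : ℕ) : Type := {s : Finset (Fin p) // s.Nonempty}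

/-- Event patterns: the number of events, and the set of channels observed at each of them. -/
abbrev Pattern (p : ℕ) : Type := Σ m : ℕ, Fin m → ObsSet p

/-- The streams with event pattern `σ` and local records in the spaces `O s`: the event times
`0 ≤ t₀ < ⋯ < t_{m-1} ≤ T` and the records, with the product topology. -/
abbrev StreamOn {p : ℕ} (T : ℝ) (O : ObsSet p → Type*) (σ : Pattern p) : Type _ :=
  {x : (Fin σ.1 → ℝ) × (∀ i, O (σ.2 i)) // StrictMono x.1 ∧ ∀ i, x.1 i ∈ Icc (0 : ℝ) T}

/-- The space of streams: the disjoint union over all event patterns. -/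
abbrev Stream {p : ℕ} (T : ℝ) (O : ObsSet p → Type*) : Type _ := Σ σ : Pattern p, StreamOn T O σ

namespace Stream

variable {p : ℕ} {T : ℝ} {O : ObsSet p → Type*}

/-- The number of events. -/
abbrev card (x : Stream T O) : ℕ := x.1.1

/-- The set of channels observed at event `i`. -/
abbrev obs (x : Stream T O) (i : Fin x.card) : ObsSet p := x.1.2 i

/-- The time of event `i`. -/
abbrev time (x : Stream T O) (i : Fin x.card) : ℝ := x.2.1.1 i

/-- The local record of event `i`. -/
abbrev record (x : Stream T O) (i : Fin x.card) : O (x.obs i) := x.2.1.2 i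

end Stream

/-- The target path space: the disjoint union over `m` of `C([0, T + m + 1], ℝ^{2p+q})`, each with
the uniform topology. -/
abbrev PathSpace (p q : ℕ) (T : ℝ) : Type :=
  Σ m : ℕ, C(Icc (0 : ℝ) (T + m + 1), Coord p q → ℝ)

/-! ### Local factors -/

/-- The assumptions on the local factors: `inc s o` is the Lie element `Δ` that stands for the local
record `o` of an event with observed set `s`, and `seg s o` is a path that realises it. -/
structure IsLocalFactorSystem {p q N : ℕ} {O : ObsSet p → Type*} [∀ s, TopologicalSpace (O s)]
    (inc : ∀ s, O s → TruncLie (Coord p q) N)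
    (seg : ∀ s, O s → C(Icc (0 : ℝ) 1, Coord p q → ℝ)) : Prop where
  inc_continuous : ∀ s, Continuous (inc s)
  inc_injective : ∀ s, Function.Injective (inc s)
  /-- The Lie elements involve only the value and count coordinates. -/
  inc_cont : ∀ s o (w : Word (Coord p q) N) (j : Fin q), Coord.cont p j ∈ w.1 → (inc s o).1 w = 0
  /-- The degree-one count coordinates are the indicator of the observed set. -/
  inc_count : ∀ s o (w : Word (Coord p q) N) (k : Fin p), w.1 = [Coord.count q k] →
    (inc s o).1 w = if k ∈ s.1 then 1 else 0
  seg_continuous : ∀ s, Continuous (seg s)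
  seg_boundedVariation : ∀ s o, BoundedVariationOn (seg s o) univ
  seg_zero : ∀ s o, seg s o 0 = 0
  /-- The realising paths move only in the value and count coordinates. -/
  seg_cont : ∀ s o u (j : Fin q), seg s o u (Coord.cont p j) = 0
  seg_signature : ∀ s o,
    signature N (extend zero_le_one (seg s o)) 0 1 = TruncTensor.exp (inc s o).1

/-! ### The path realisation -/

/-- A vector of continuous variables, embedded in the last `q` coordinates. -/
def embed (p : ℕ) {q : ℕ} (c : Fin q → ℝ) : Coord p q → ℝ := Sum.elim 0 (Sum.elim 0 c)

theorem continuous_embed (p q : ℕ) : Continuous (embed p : (Fin q → ℝ) → Coord p q → ℝ) := by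
  refine continuous_pi fun i => ?_
  rcases i with i | i | i
  · exact continuous_const
  · exact continuous_const
  · exact continuous_apply i

/-- `min {1, max {0, u}}`. -/
def ramp (u : ℝ) : ℝ := min 1 (max 0 u)

theorem continuous_ramp : Continuous ramp := by
  unfold ramp
  fun_prop

theorem ramp_mem (u : ℝ) : ramp u ∈ Icc (0 : ℝ) 1 :=
  ⟨le_min zero_le_one (le_max_left _ _), min_le_left _ _⟩

section Realisation

variable {p q N : ℕ} {T : ℝ} {τ : Fin q} {O : ObsSet p → Type*}

/-- The auxiliary-time parameter `ρ_i` of event `i`. -/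
def eventRamp (x : Stream T O) (i : Fin x.card) (u : ℝ) : ℝ := ramp (u - 1 - x.time i - (i : ℕ))

/-- The physical time `q_x(u)` reached at auxiliary time `u`. -/
def physTime (x : Stream T O) (u : ℝ) : ℝ := u - ramp u - ∑ i, eventRamp x i u

theorem continuous_eventRamp (x : Stream T O) (i : Fin x.card) : Continuous (eventRamp x i) := by
  unfold eventRamp
  exact continuous_ramp.comp (by fun_prop)

theorem continuous_physTime (x : Stream T O) : Continuous (physTime x) := by
  unfold physTime
  exact (continuous_id.sub continuous_ramp).sub
    (continuous_finsetSum _ fun i _ => continuous_eventRamp x i)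

/-- The path `C`, embedded in the last `q` coordinates of `ℝ^{2p+q}` (and continued by its end
values outside `[0, T]`). -/
def contPart (p : ℕ) (hT : 0 ≤ T) (C : ContPath q T τ) (t : ℝ) : Coord p q → ℝ :=
  embed p (extend hT C.1 t)

theorem continuous_contPart (p : ℕ) (hT : 0 ≤ T) (C : ContPath q T τ) :
    Continuous (contPart p hT C) :=
  (continuous_embed p q).comp (C.1.continuous.Icc_extend')

/-- The path realisation
`Ψ(u) = ρ_*(u) C̃₀ + (C̃(q_x(u)) - C̃₀) + ∑ᵢ ηᵢ(ρᵢ(u))` on `[0, T + m + 1]`. -/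
def realisation (hT : 0 ≤ T) (seg : ∀ s, O s → C(Icc (0 : ℝ) 1, Coord p q → ℝ))
    (D : ContPath q T τ × Stream T O) : PathSpace p q T :=
  ⟨D.2.card,
    { toFun := fun u =>
        ramp u • contPart p hT D.1 0
          + (contPart p hT D.1 (physTime D.2 u) - contPart p hT D.1 0)
          + ∑ i, seg (D.2.obs i) (D.2.record i) ⟨eventRamp D.2 i u, ramp_mem _⟩
      continuous_toFun := by
        have h1 := continuous_ramp
        have h2 := continuous_contPart p hT D.1
        have h3 := continuous_physTime D.2
        have h4 := continuous_eventRamp D.2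
        refine (((h1.comp continuous_subtype_val).smul continuous_const).add
          ((h2.comp (h3.comp continuous_subtype_val)).sub continuous_const)).add
          (continuous_finsetSum _ fun i _ => ?_)
        exact (seg _ _).continuous.comp
          (((h4 i).comp continuous_subtype_val).subtype_mk _) }⟩

end Realisation

/-! ### Physical-time intervals of a path -/

section Intervals

variable {p q : ℕ} {T : ℝ}

/-- The first auxiliary time at which the time channel `τ` of the path equals `t`. -/
def startTime (τ : Fin q) (Y : PathSpace p q T) (t : ℝ) : ℝ :=
  sInf {u : ℝ | ∃ h : u ∈ Icc (0 : ℝ) (T + Y.1 + 1), Y.2 ⟨u, h⟩ (Coord.cont p τ) = t}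

/-- The auxiliary time at which the physical-time interval `[α, β)` ends; for `β = T` it is the
last one, so that events at `T` are included. -/
def endTime (τ : Fin q) (Y : PathSpace p q T) (β : ℝ) : ℝ :=
  if β < T then startTime τ Y β else T + Y.1 + 1

/-- The truncated signature of a path over the physical-time interval `[α, β)`. -/
def intervalSignature (N : ℕ) (hT : 0 ≤ T) (τ : Fin q) (Y : PathSpace p q T) (α β : ℝ) :
    TruncTensor (Coord p q) N :=
  signature N (extend (by positivity) Y.2) (startTime τ Y α) (endTime τ Y β)

end Intervals

/-! ### Interval summaries -/

section Summary

variable {p q N : ℕ} {T : ℝ} {τ : Fin q} {O : ObsSet p → Type*}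

/-- The gap factor `Γ_{u,v}`: the truncated signature of the embedded path `C` over `[u, v]`. -/
def gapFactor (p N : ℕ) (hT : 0 ≤ T) (C : ContPath q T τ) (u v : ℝ) : TruncTensor (Coord p q) N :=
  signature N (contPart p hT C) u v

/-- The event factor `E_i = exp(Δ_i)`. -/
def eventFactor (inc : ∀ s, O s → TruncLie (Coord p q) N) (x : Stream T O) (i : Fin x.card) :
    TruncTensor (Coord p q) N :=
  TruncTensor.exp (inc (x.obs i) (x.record i)).1

/-- The events assigned to `[α, β)`, in order of time; events at `T` belong to the intervals that
end at `T`. -/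
def eventsIn (x : Stream T O) (α β : ℝ) : List (Fin x.card) :=
  open Classical in
  (List.finRange x.card).filter fun i => α ≤ x.time i ∧ (x.time i < β ∨ β = T)

/-- The ordered product `Γ_{α,t_{i₁}} ⊗ E_{i₁} ⊗ Γ_{t_{i₁},t_{i₂}} ⊗ E_{i₂} ⊗ ⋯ ⊗ Γ_{t_{i_r},β}`
over a list `i₁, …, i_r` of events. -/
def factorProduct (hT : 0 ≤ T) (inc : ∀ s, O s → TruncLie (Coord p q) N) (C : ContPath q T τ)
    (x : Stream T O) (β : ℝ) : List (Fin x.card) → ℝ → TruncTensor (Coord p q) N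
  | [], α => gapFactor p N hT C α β
  | i :: l, α => gapFactor p N hT C α (x.time i) * eventFactor inc x i *
      factorProduct hT inc C x β l (x.time i)

/-- The interval signature `G_{α,β}(x, C)`; for `α = 0` it starts with `B_C = exp(C̃₀)`. -/
def intervalProduct (hT : 0 ≤ T) (inc : ∀ s, O s → TruncLie (Coord p q) N)
    (D : ContPath q T τ × Stream T O) (α β : ℝ) : TruncTensor (Coord p q) N :=
  (if α = 0 then TruncTensor.exp (TruncTensor.ofVec (contPart p hT D.1 0)) else 1) *
    factorProduct hT inc D.1 D.2 β (eventsIn D.2 α β) α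

/-- The interval summary `Φ_{α,β}(x, C) = log G_{α,β}(x, C)`. -/
def intervalSummary (hT : 0 ≤ T) (inc : ∀ s, O s → TruncLie (Coord p q) N)
    (D : ContPath q T τ × Stream T O) (α β : ℝ) : TruncTensor (Coord p q) N :=
  TruncTensor.log (intervalProduct hT inc D α β)

end Summary

/-! ### The default construction from raw observed values -/

/-- One real number for each observed channel. -/
abbrev Values {p : ℕ} (s : ObsSet p) : Type := {k // k ∈ s.1} → ℝ

section Default

variable {p : ℕ} {T : ℝ}

/-- The number recorded for channel `k`, with value `0` if the channel is not observed. -/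
def valueAt {s : ObsSet p} (v : Values s) (k : Fin p) : ℝ :=
  if h : k ∈ s.1 then v ⟨k, h⟩ else 0

/-- The increment vector `∑_{k ∈ s} (v_k e_k + e_{p+k})`. -/
def eventVector (q : ℕ) {s : ObsSet p} (v : Values s) : Coord p q → ℝ :=
  Sum.elim (valueAt v) (Sum.elim (fun k => if k ∈ s.1 then 1 else 0) 0)

/-- The default Lie element: the increment vector, placed in degree one. -/
def defaultInc (p q N : ℕ) (s : ObsSet p) (v : Values s) : TruncLie (Coord p q) N :=
  ⟨TruncTensor.ofVec (eventVector q v), LieSubalgebra.subset_lieSpan (mem_range_self _)⟩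

/-- The default realising path `u ↦ u δ`. -/
def defaultSeg (p q : ℕ) (s : ObsSet p) (v : Values s) : C(Icc (0 : ℝ) 1, Coord p q → ℝ) where
  toFun u := (u : ℝ) • eventVector q v

/-- The value of channel `k` at its most recent observation before event `i`, and `0` if there
is none. -/
def prevValue (x : Stream T (Values (p := p))) (i : Fin x.card) (k : Fin p) : ℝ :=
  if h : (Finset.univ.filter fun j => j < i ∧ k ∈ (x.obs j).1).Nonempty then
    valueAt (x.record ((Finset.univ.filter fun j => j < i ∧ k ∈ (x.obs j).1).max' h)) k
  else 0

/-- Replace the observed values of a stream by their increments since the previous observation of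
the same channel. -/
def increments (x : Stream T (Values (p := p))) : Stream T (Values (p := p)) :=
  ⟨x.1, ⟨(x.2.1.1, fun i k => x.record i k - prevValue x i k), x.2.2⟩⟩

end Default

end StreamEmbedding

end

noncomputable section

namespace StreamEmbedding

/-! ### Functions of bounded variation -/

section BoundedVariation

variable {α : Type*} [LinearOrder α] {E : Type*} [SeminormedAddCommGroup E] {f g : α → E} {s : Set α}

/-! Auxiliary time falls into three kinds of pieces: the initial interval `[0, 1]`, one unit
interval `[1 + tᵢ + i, 2 + tᵢ + i]` for each event, and the gaps between them. Physical time stands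
still on the first two kinds and runs at unit speed in the gaps. Up to a translation in space and
time, the path on these pieces is respectively the segment from `0` to `C̃₀`, the event path, and a
piece of `C̃`.

Interval identity: signatures depend only on increments (`iteratedIntegral_translate`), so the
pieces contribute `B_C` (`signature_linear`), `E_i` and `Γ`. Chen's identity
(`iteratedIntegral_chen`) multiplies them in order. The hitting times are `1 + α + j`, with `j` the
number of events strictly before `α > 0`, and `0` for `α = 0` (`startTime_of_pos`,
`startTime_zero`); this puts each event and the factor `B_C` into the right interval. The two sides
therefore agree even before taking logarithms.

Injectivity: the component of the path gives the number of events. Its time channel is `q_x`, which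
determines the event times (`eq_of_sum_eventRamp_eq`). Restriction to an event interval gives the
event path, hence its signature, hence the Lie element, because `exp` is injective on tensors
without constant term (`exp_injOn`). The count coordinates then give the observed set and
injectivity of `inc` gives the record. Finally `C` is read off at auxiliary times with prescribed
physical time.

Continuity is checked on each event pattern as joint continuity in the input and auxiliary time. The
raw-stream case composes the local-factor case with the passage to increments, which is continuous
and injective. -/

theorem eVariationOn_add_le (f g : α → E) (s : Set α) :
    eVariationOn (f + g) s ≤ eVariationOn f s + eVariationOn g s := by
  refine iSup_le fun p => ?_
  calc ∑ i ∈ Finset.range p.1, edist ((f + g) (p.2.1 (i + 1))) ((f + g) (p.2.1 i))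
      ≤ ∑ i ∈ Finset.range p.1, (edist (f (p.2.1 (i + 1))) (f (p.2.1 i)) +
          edist (g (p.2.1 (i + 1))) (g (p.2.1 i))) :=
        Finset.sum_le_sum fun i _ => edist_add_add_le _ _ _ _
    _ ≤ _ := by
        rw [Finset.sum_add_distrib]
        exact add_le_add (eVariationOn.sum_le p.2.2.1 p.2.2.2)
          (eVariationOn.sum_le p.2.2.1 p.2.2.2)

theorem boundedVariationOn_add (hf : BoundedVariationOn f s) (hg : BoundedVariationOn g s) :
    BoundedVariationOn (f + g) s :=
  ((eVariationOn_add_le f g s).trans_lt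
    (ENNReal.add_lt_top.2 ⟨hf.lt_top, hg.lt_top⟩)).ne

theorem boundedVariationOn_const (c : E) : BoundedVariationOn (fun _ : α => c) s := by
  have : eVariationOn (fun _ : α => c) s = 0 :=
    eVariationOn.constant_on (subsingleton_singleton.anti (image_subset_iff.2 fun x _ => rfl))
  simp [BoundedVariationOn, this]

theorem boundedVariationOn_sum {ι : Type*} (t : Finset ι) {F : ι → α → E}
    (h : ∀ i ∈ t, BoundedVariationOn (F i) s) :
    BoundedVariationOn (fun x => ∑ i ∈ t, F i x) s := by
  classical
  induction t using Finset.induction_on with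
  | empty => simpa using boundedVariationOn_const (0 : E)
  | insert a t ha ih =>
    simp only [Finset.sum_insert ha]
    exact boundedVariationOn_add (h a (by simp)) (ih fun i hi => h i (by simp [hi]))

theorem boundedVariationOn_comp_monotone {β : Type*} [LinearOrder β] {t : Set β}
    (hf : BoundedVariationOn f s) {φ : β → α} (hφ : MonotoneOn φ t) (hst : MapsTo φ t s) :
    BoundedVariationOn (f ∘ φ) t :=
  ((eVariationOn.comp_le_of_monotoneOn f φ hφ hst).trans_lt hf.lt_top).ne

theorem boundedVariationOn_coord {ι : Type*} [Fintype ι] {X : α → ι → ℝ}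
    (hX : BoundedVariationOn X s) (i : ι) : BoundedVariationOn (fun u => X u i) s :=
  (LipschitzWith.eval (α := fun _ : ι => ℝ) i).comp_boundedVariationOn hX

theorem boundedVariationOn_extend {A : Type*} [Fintype A] {a b : ℝ} (h : a ≤ b)
    {X : C(Icc a b, A → ℝ)} (hX : BoundedVariationOn X univ) :
    BoundedVariationOn (extend h X) univ :=
  boundedVariationOn_comp_monotone hX ((monotone_projIcc h).monotoneOn _) (mapsTo_univ _ _)

theorem boundedVariationOn_restrict {A : Type*} [Fintype A] {a b : ℝ} {X : C(Icc a b, A → ℝ)}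
    {f : ℝ → A → ℝ} (hf : BoundedVariationOn f univ) (h : ∀ u, X u = f u) :
    BoundedVariationOn X univ := by
  have : (X : Icc a b → A → ℝ) = f ∘ Subtype.val := funext h
  rw [this]
  exact boundedVariationOn_comp_monotone hf (fun _ _ _ _ h => h) (mapsTo_univ _ _)

end BoundedVariation

/-! ### Integration against signed measures -/

section SignedMeasure

variable {Ω : Type*} [MeasurableSpace Ω]

instance isFiniteMeasure_variation (μ : SignedMeasure Ω) : IsFiniteMeasure μ.variation := by
  rw [← SignedMeasure.totalVariation_eq_variation]
  unfold SignedMeasure.totalVariation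
  infer_instance

theorem integrable_of_measurable_bounded (μ : SignedMeasure Ω) {g : Ω → ℝ} (hg : Measurable g)
    {c : ℝ} (hc : ∀ x, |g x| ≤ c) : μ.Integrable g :=
  Integrable.of_bound hg.aestronglyMeasurable c (.of_forall hc)

theorem setIntegral_toSignedMeasure_lsmul (μ : Measure Ω) [IsFiniteMeasure μ] (g : Ω → ℝ)
    {s : Set Ω} (hs : MeasurableSet s) :
    ∫ᵛ x in s, g x ∂•μ.toSignedMeasure = ∫ x in s, g x ∂μ := by
  rw [← VectorMeasure.setIntegral_toSignedMeasure hs]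
  congr 1
  ext
  simp

theorem setIntegral_mul_const (μ : SignedMeasure Ω) (s : Set Ω) (g : Ω → ℝ) (c : ℝ) :
    ∫ᵛ x in s, g x * c ∂•μ = (∫ᵛ x in s, g x ∂•μ) * c := by
  simp_rw [mul_comm _ c]
  exact VectorMeasure.integral_fun_smul _ _ c g

end SignedMeasure

/-! ### Integrals over half-open intervals of the line -/

theorem measurable_setIntegral_Ioc_measure (μ : Measure ℝ) [IsFiniteMeasure μ] {g : ℝ → ℝ}
    (hg : Measurable g) (t : ℝ) : Measurable fun u => ∫ v in Ioc u t, g v ∂μ := by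
  -- The moving interval is a section of a measurable set in the plane, so measurability of partial
  -- integrals applies.
  have : (fun u => ∫ v in Ioc u t, g v ∂μ) =
      fun u => ∫ v, {z : ℝ × ℝ | z.1 < z.2 ∧ z.2 ≤ t}.indicator (fun z => g z.2) (u, v) ∂μ := by
    funext u
    rw [← integral_indicator measurableSet_Ioc]
    rfl
  rw [this]
  refine (StronglyMeasurable.integral_prod_right ?_).measurable
  refine ((hg.comp measurable_snd).indicator ?_).stronglyMeasurable
  exact (measurableSet_lt measurable_fst measurable_snd).inter
    (measurableSet_le measurable_snd measurable_const)

/-- Measurability in the lower limit allows the integral to serve as the integrand at the next level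
of iteration. The Jordan decomposition reduces it to finite positive measures. -/
theorem measurable_setIntegral_Ioc (μ : SignedMeasure ℝ) {g : ℝ → ℝ} (hg : Measurable g)
    {c : ℝ} (hc : ∀ x, |g x| ≤ c) (t : ℝ) :
    Measurable fun u => ∫ᵛ v in Ioc u t, g v ∂•μ := by
  have key : (fun u => ∫ᵛ v in Ioc u t, g v ∂•μ) = fun u =>
      (∫ v in Ioc u t, g v ∂μ.toJordanDecomposition.posPart) -
        ∫ v in Ioc u t, g v ∂μ.toJordanDecomposition.negPart := by
    funext u
    conv_lhs => rw [← μ.toSignedMeasure_toJordanDecomposition]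
    rw [JordanDecomposition.toSignedMeasure, VectorMeasure.restrict_sub,
      VectorMeasure.integral_sub_vectorMeasure
        (integrable_of_measurable_bounded _ hg hc).integrableOn
        (integrable_of_measurable_bounded _ hg hc).integrableOn,
      setIntegral_toSignedMeasure_lsmul _ _ measurableSet_Ioc,
      setIntegral_toSignedMeasure_lsmul _ _ measurableSet_Ioc]
  rw [key]
  exact (measurable_setIntegral_Ioc_measure _ hg t).sub (measurable_setIntegral_Ioc_measure _ hg t)

theorem abs_setIntegral_Ioc_le (μ : SignedMeasure ℝ) {g : ℝ → ℝ} {c : ℝ} (hc : ∀ x, |g x| ≤ c)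
    (u t : ℝ) : |∫ᵛ v in Ioc u t, g v ∂•μ| ≤
      c * ‖(ContinuousLinearMap.lsmul ℝ ℝ : ℝ →L[ℝ] ℝ →L[ℝ] ℝ)‖ * μ.variation.real univ := by
  have hc0 : 0 ≤ c := (abs_nonneg _).trans (hc 0)
  have h := VectorMeasure.norm_setIntegral_le_of_norm_le_const (μ := μ) (s := Ioc u t) (f := g)
    (B := ContinuousLinearMap.lsmul ℝ ℝ) (C := c) fun x _ => hc x
  refine h.trans ?_
  exact mul_le_mul_of_nonneg_left (measureReal_mono (subset_univ _)) (by positivity)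

/-- Signed measures that agree on the half-open subintervals of `(s, t]` agree on `(s, t]`. -/
theorem restrict_Ioc_eq (μ ν : SignedMeasure ℝ) {s t : ℝ}
    (h : ∀ a b, s ≤ a → a ≤ b → b ≤ t → μ (Ioc a b) = ν (Ioc a b)) :
    μ.restrict (Ioc s t) = ν.restrict (Ioc s t) := by
  -- Intersecting with `(s, t]` leaves a half-open subinterval or nothing, so the restricted
  -- measures agree on the π-system of all half-open intervals.
  have h' : ∀ a b, μ (Ioc a b ∩ Ioc s t) = ν (Ioc a b ∩ Ioc s t) := fun a b => by
    rw [Ioc_inter_Ioc]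
    rcases le_or_gt (a ⊔ s) (b ⊓ t) with hle | hlt
    · exact h _ _ le_sup_right hle inf_le_right
    · simp [Ioc_eq_empty_of_le hlt.le]
  refine VectorMeasure.ext_of_generateFrom {S | ∃ l u, l < u ∧ Ioc l u = S} ?_
    (BorelSpace.measurable_eq.trans (borel_eq_generateFrom_Ioc ℝ)) ?_ ?_
  · rintro _ ⟨l, u, -, rfl⟩
    rw [VectorMeasure.restrict_apply _ measurableSet_Ioc measurableSet_Ioc,
      VectorMeasure.restrict_apply _ measurableSet_Ioc measurableSet_Ioc]
    exact h' l u
  · exact isPiSystem_Ioc id id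
  · rw [VectorMeasure.restrict_apply _ measurableSet_Ioc MeasurableSet.univ,
      VectorMeasure.restrict_apply _ measurableSet_Ioc MeasurableSet.univ, univ_inter]
    simpa using h' s t

/-- For a general function of bounded variation the right limits at the endpoints appear; continuity
removes them. -/
theorem stieltjes_Ioc {f : ℝ → ℝ} (hf : BoundedVariationOn f univ) (hc : Continuous f) {a b : ℝ}
    (hab : a ≤ b) : stieltjes f (Ioc a b) = f b - f a := by
  rw [stieltjes, dif_pos hf, hf.vectorMeasure_Ioc hab]
  rw [hc.continuousWithinAt.rightLim_eq, hc.continuousWithinAt.rightLim_eq]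

/-! ### Iterated integrals -/

section IteratedIntegral

variable {A : Type*} {X Y : ℝ → A → ℝ}

/-- Measurability and boundedness must be carried together through the induction: they make the
integrand integrable for the next, finite, Stieltjes measure. -/
theorem measurable_bounded_iteratedIntegral (X : ℝ → A → ℝ) (t : ℝ) (w : List A) :
    (Measurable fun u => iteratedIntegral X w u t) ∧ ∃ c, ∀ u, |iteratedIntegral X w u t| ≤ c := by
  induction w with
  | nil => exact ⟨measurable_const, 1, fun u => by simp [iteratedIntegral]⟩
  | cons i w ih =>
    obtain ⟨hm, c, hc⟩ := ih
    exact ⟨measurable_setIntegral_Ioc _ hm hc t, _, fun u => abs_setIntegral_Ioc_le _ hc u t⟩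

theorem integrable_iteratedIntegral (μ : SignedMeasure ℝ) (X : ℝ → A → ℝ) (t : ℝ) (w : List A) :
    μ.Integrable fun u => iteratedIntegral X w u t :=
  let ⟨hm, _, hc⟩ := measurable_bounded_iteratedIntegral X t w
  integrable_of_measurable_bounded μ hm hc

/-- Chen's identity for a single word. -/
theorem iteratedIntegral_chen (X : ℝ → A → ℝ) {m t : ℝ} (hmt : m ≤ t) (w : List A) :
    ∀ {s : ℝ}, s ≤ m → iteratedIntegral X w s t =
      ∑ k ∈ Finset.range (w.length + 1),
        iteratedIntegral X (w.take k) s m * iteratedIntegral X (w.drop k) m t := by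
  induction w with
  | nil => intro s _; simp [iteratedIntegral]
  | cons i w ih =>
    intro s hsm
    -- Split according to the position of `u₁`. The part `u₁ > m` is the term with empty prefix; for
    -- `u₁ ≤ m` the induction hypothesis expands the inner integral.
    rw [List.length_cons, Finset.sum_range_succ']
    simp only [List.take_succ_cons, List.drop_succ_cons, List.take_zero, List.drop_zero]
    simp only [iteratedIntegral, one_mul]
    rw [← Ioc_union_Ioc_eq_Ioc hsm hmt, VectorMeasure.setIntegral_union
      (Set.disjoint_left.2 fun x hx hx' => absurd hx.2 (not_le.2 hx'.1)) measurableSet_Ioc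
      measurableSet_Ioc (integrable_iteratedIntegral _ X t w).integrableOn
      (integrable_iteratedIntegral _ X t w).integrableOn]
    congr 1
    rw [VectorMeasure.setIntegral_congr_fun (fun u hu => ih (mem_Ioc.1 hu).2),
      VectorMeasure.integral_finsetSum]
    · exact Finset.sum_congr rfl fun k _ => setIntegral_mul_const _ _ _ _
    · intro k _
      exact ((integrable_iteratedIntegral _ X m _).mul_const _)

/-- Iterated integrals depend only on the increments of the path over the interval of integration,
and are invariant under translation of the time parameter. -/
theorem iteratedIntegral_translate (hX : Continuous X) (hY : Continuous Y)
    (hXv : ∀ i, BoundedVariationOn (fun u => X u i) univ)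
    (hYv : ∀ i, BoundedVariationOn (fun u => Y u i) univ) {t c : ℝ} (w : List A) :
    ∀ {s : ℝ}, (∀ u ∈ Icc s t, ∀ i, X u i - X s i = Y (u + c) i - Y (s + c) i) →
      iteratedIntegral X w s t = iteratedIntegral Y w (s + c) (t + c) := by
  induction w with
  | nil => intro s _; rfl
  | cons i w ih =>
    intro s h
    have hemb : MeasurableEmbedding fun u : ℝ => u - c := measurableEmbedding_subRight c
    have hmeas : (stieltjes fun v => X v i).restrict (Ioc s t) =
        ((stieltjes fun v => Y v i).map fun u => u - c).restrict (Ioc s t) := by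
      refine restrict_Ioc_eq _ _ fun a b hsa hab hbt => ?_
      have hpre : (fun u : ℝ => u - c) ⁻¹' Ioc a b = Ioc (a + c) (b + c) := by
        ext u; simp
      rw [VectorMeasure.map_apply _ hemb.measurable measurableSet_Ioc, hpre,
        stieltjes_Ioc (hXv i) ((continuous_apply i).comp hX) hab,
        stieltjes_Ioc (hYv i) ((continuous_apply i).comp hY) (by linarith)]
      have ha := h a ⟨hsa, hab.trans hbt⟩ i
      have hb := h b ⟨hsa.trans hab, hbt⟩ i
      linarith
    have hpre : (fun u : ℝ => u - c) ⁻¹' Ioc s t = Ioc (s + c) (t + c) := by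
      ext u; simp
    simp only [iteratedIntegral]
    rw [hmeas, hemb.setIntegral_map_vectorMeasure measurableSet_Ioc, hpre]
    refine VectorMeasure.setIntegral_congr_fun fun u hu => ?_
    have hu' : u - c ∈ Icc s t := ⟨by linarith [hu.1], by linarith [hu.2]⟩
    change iteratedIntegral X w (u - c) t = _
    rw [ih, sub_add_cancel]
    -- Increments from the new base point are differences of increments from `s`.
    intro v hv j
    have h1 := h v ⟨hu'.1.trans hv.1, hv.2⟩ j
    have h2 := h (u - c) hu' j
    linarith

theorem signature_mul {N : ℕ} (X : ℝ → A → ℝ) {s m t : ℝ} (hsm : s ≤ m) (hmt : m ≤ t) :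
    signature N X s t = signature N X s m * signature N X m t :=
  TruncTensor.ext' fun w => iteratedIntegral_chen X hmt w.1 hsm

theorem signature_translate {N : ℕ} [Fintype A] (hX : Continuous X) (hY : Continuous Y)
    (hXv : BoundedVariationOn X univ) (hYv : BoundedVariationOn Y univ) {s t c : ℝ}
    (h : ∀ u ∈ Icc s t, X u - X s = Y (u + c) - Y (s + c)) :
    signature N X s t = signature N Y (s + c) (t + c) :=
  TruncTensor.ext' fun w => iteratedIntegral_translate hX hY (boundedVariationOn_coord hXv)
    (boundedVariationOn_coord hYv) w.1 fun u hu i => congrFun (h u hu) i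

end IteratedIntegral

/-! ### The exponential in the truncated tensor algebra -/

namespace TruncTensor

variable {A : Type*} {N : ℕ}

theorem ofVec_nil (v : A → ℝ) (h : ([] : List A).length ≤ N) :
    (ofVec v : TruncTensor A N) ⟨[], h⟩ = 0 := rfl

theorem mul_nil (a b : TruncTensor A N) (h : ([] : List A).length ≤ N) :
    (a * b) ⟨[], h⟩ = a ⟨[], h⟩ * b ⟨[], h⟩ := by
  simp [mul_apply, take, drop]

/-- A left factor of degree one sees only the splitting after the first letter. -/
theorem ofVec_mul_cons (v : A → ℝ) (b : TruncTensor A N) (i : A) (w : List A)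
    (h : (i :: w).length ≤ N) :
    (ofVec v * b : TruncTensor A N) ⟨i :: w, h⟩ = v i * b ⟨w, (Nat.le_succ _).trans h⟩ := by
  rw [mul_apply, Finset.sum_eq_single 1]
  · simp [take, drop, ofVec]
  · rintro (_ | _ | k) hk hk1
    · simp [take, ofVec]
    · exact absurd rfl hk1
    · rcases w with _ | ⟨j, w⟩
      · simp at hk
      · simp [take, ofVec]
  · intro h
    simp at h

theorem ofVec_pow (v : A → ℝ) (n : ℕ) (w : Word A N) :
    ((ofVec v : TruncTensor A N) ^ n) w = if w.1.length = n then (w.1.map v).prod else 0 := by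
  induction n generalizing w with
  | zero =>
    rw [pow_zero, one_apply]
    rcases w with ⟨_ | ⟨i, w⟩, h⟩ <;> simp
  | succ n ih =>
    rw [pow_succ']
    rcases w with ⟨_ | ⟨i, w⟩, h⟩
    · rw [mul_nil, ofVec_nil]
      simp
    · rw [ofVec_mul_cons, ih]
      simp

theorem sum_apply {ι : Type*} (s : Finset ι) (f : ι → TruncTensor A N) (w : Word A N) :
    (∑ i ∈ s, f i) w = ∑ i ∈ s, f i w :=
  Finset.sum_apply w s f

theorem exp_apply (a : TruncTensor A N) (w : Word A N) :
    exp a w = ∑ n ∈ Finset.range (N + 1), (n.factorial : ℝ)⁻¹ * (a ^ n) w :=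
  sum_apply _ _ _

theorem exp_ofVec (v : A → ℝ) (w : Word A N) :
    exp (ofVec v) w = (w.1.length.factorial : ℝ)⁻¹ * (w.1.map v).prod := by
  rw [exp_apply, Finset.sum_eq_single w.1.length]
  · rw [ofVec_pow, if_pos rfl]
  · intro n _ hn
    rw [ofVec_pow, if_neg hn.symm, mul_zero]
  · intro h
    exact absurd (Finset.mem_range.2 (Nat.lt_succ_of_le w.2)) h

theorem take_length_le (k : ℕ) (w : Word A N) : (take k w).1.length ≤ w.1.length :=
  List.length_take_le' k w.1

theorem drop_length_le (k : ℕ) (w : Word A N) : (drop k w).1.length ≤ w.1.length := by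
  simp [drop]

/-- A coordinate of a product involves only prefixes and suffixes of its word, and these are no
longer than the word. -/
theorem pow_apply_congr {a b : TruncTensor A N} {l : ℕ}
    (h : ∀ w : Word A N, w.1.length ≤ l → a w = b w) (n : ℕ) (w : Word A N) (hw : w.1.length ≤ l) :
    (a ^ n) w = (b ^ n) w := by
  induction n generalizing w with
  | zero => rfl
  | succ n ih =>
    rw [pow_succ', pow_succ', mul_apply, mul_apply]
    refine Finset.sum_congr rfl fun k _ => ?_
    rw [h _ ((take_length_le k w).trans hw), ih _ ((drop_length_le k w).trans hw)]

theorem pow_succ_nil {a : TruncTensor A N} (ha : a ⟨[], Nat.zero_le N⟩ = 0) (n : ℕ)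
    (w : Word A N) (hw : w.1 = []) : (a ^ (n + 1)) w = 0 := by
  obtain ⟨w, h⟩ := w
  obtain rfl : w = [] := hw
  rw [pow_succ', mul_nil, ha, zero_mul]

/-- Powers of degree at least two of tensors without a degree-zero part involve only the coordinates
of strictly shorter words. -/
theorem pow_apply_congr_of_lt {a b : TruncTensor A N} (ha : a ⟨[], Nat.zero_le N⟩ = 0)
    (hb : b ⟨[], Nat.zero_le N⟩ = 0) {w : Word A N}
    (h : ∀ w' : Word A N, w'.1.length < w.1.length → a w' = b w') (n : ℕ) :
    (a ^ (n + 2)) w = (b ^ (n + 2)) w := by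
  rw [pow_succ' a, pow_succ' b, mul_apply, mul_apply]
  refine Finset.sum_congr rfl fun k hk => ?_
  have hk' : k ≤ w.1.length := Nat.lt_succ_iff.1 (Finset.mem_range.1 hk)
  -- The two extreme splittings vanish: an empty prefix meets the zero constant term of the first
  -- factor, an empty suffix that of the remaining power, whose exponent is at least one. All other
  -- splittings have two strictly shorter parts.
  rcases Nat.eq_zero_or_pos k with rfl | hk0
  · have h0 : take 0 w = ⟨[], Nat.zero_le N⟩ := by simp [take]
    rw [h0, ha, hb, zero_mul, zero_mul]
  rcases hk'.eq_or_lt with rfl | hlt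
  · have h0 : (drop w.1.length w).1 = [] := by simp [drop]
    rw [pow_succ_nil ha n _ h0, pow_succ_nil hb n _ h0, mul_zero, mul_zero]
  · rw [h (take k w) (by simp [take]; omega),
      pow_apply_congr (l := w.1.length - 1) (fun w' hw' => h w' (by omega)) (n + 1) (drop k w)
        (by simp [drop]; omega)]

/-- The exponential is injective on tensors without a degree-zero part. -/
theorem exp_injOn {a b : TruncTensor A N} (ha : a ⟨[], Nat.zero_le N⟩ = 0)
    (hb : b ⟨[], Nat.zero_le N⟩ = 0) (h : exp a = exp b) : a = b := by
  suffices ∀ l, ∀ w : Word A N, w.1.length = l → a w = b w from ext' fun w => this _ w rfl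
  -- Induction on word length: in `exp a w` the linear term is `a w` itself, and all higher powers
  -- involve only shorter words, where `a` and `b` already agree.
  intro l
  induction l using Nat.strong_induction_on with
  | _ l ih =>
    intro w hw
    rcases Nat.eq_zero_or_pos l with rfl | hl
    · obtain ⟨w, hwN⟩ := w
      obtain rfl := List.eq_nil_of_length_eq_zero hw
      rw [ha, hb]
    have h1 : 1 ∈ Finset.range (N + 1) := by
      have := w.2
      simp
      omega
    have hw' := congrFun h w
    change exp a w = exp b w at hw'
    rw [exp_apply, exp_apply, ← Finset.add_sum_erase _ _ h1, ← Finset.add_sum_erase _ _ h1] at hw'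
    have hsum : ∑ n ∈ (Finset.range (N + 1)).erase 1, (n.factorial : ℝ)⁻¹ * (a ^ n) w =
        ∑ n ∈ (Finset.range (N + 1)).erase 1, (n.factorial : ℝ)⁻¹ * (b ^ n) w := by
      refine Finset.sum_congr rfl fun n hn => ?_
      rcases n with _ | _ | n
      · rw [pow_zero, pow_zero]
      · simp at hn
      · rw [pow_apply_congr_of_lt ha hb (fun w' hlt => ih _ (hw ▸ hlt) w' rfl)]
    simpa [hsum] using hw'

/-- Taking constant terms is multiplicative, so sums, multiples and brackets of tensors without
constant term have none. This puts Lie elements in the range of `exp_injOn`. -/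
theorem apply_nil_of_mem_truncLie {a : TruncTensor A N} (ha : a ∈ TruncLie A N) :
    a ⟨[], Nat.zero_le N⟩ = 0 := by
  induction ha using LieSubalgebra.lieSpan_induction with
  | mem x hx => obtain ⟨v, rfl⟩ := hx; rfl
  | zero => rfl
  | add x y _ _ hx hy => rw [add_apply, hx, hy, add_zero]
  | smul r x _ hx => rw [smul_apply, hx, mul_zero]
  | lie x y _ _ hx hy =>
    rw [LieRing.of_associative_ring_bracket, sub_eq_add_neg, ← neg_one_smul ℝ, add_apply,
      smul_apply, mul_nil, mul_nil, hx, hy]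
    simp

end TruncTensor

/-! ### The signature of a linear path -/

section Linear

theorem monotone_ramp : Monotone ramp := fun _ _ h => by
  unfold ramp
  gcongr

theorem ramp_of_mem {u : ℝ} (hu : u ∈ Icc (0 : ℝ) 1) : ramp u = u := by
  rw [ramp, max_eq_right hu.1, min_eq_right hu.2]

theorem ramp_of_nonpos {u : ℝ} (hu : u ≤ 0) : ramp u = 0 := by
  rw [ramp, max_eq_left hu, min_eq_right zero_le_one]

theorem ramp_of_one_le {u : ℝ} (hu : 1 ≤ u) : ramp u = 1 := by
  rw [ramp, max_eq_right (zero_le_one.trans hu), min_eq_left hu]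

variable {A : Type*} {X : ℝ → A → ℝ}

/-- On `[0, 1]` each `dXⁱ` is `vᵢ` times Lebesgue measure. The lower limit is kept variable so that
the induction becomes the integration of `(1 - u)ⁿ` over `[s, 1]`. -/
theorem iteratedIntegral_linear (hX : Continuous X)
    (hXv : ∀ i, BoundedVariationOn (fun u => X u i) univ) (v : A → ℝ)
    (h : ∀ u ∈ Icc (0 : ℝ) 1, ∀ i, X u i - X 0 i = u * v i) (w : List A) :
    ∀ {s : ℝ}, s ∈ Icc (0 : ℝ) 1 → iteratedIntegral X w s 1 =
      (1 - s) ^ w.length * ((w.length.factorial : ℝ)⁻¹ * (w.map v).prod) := by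
  induction w with
  | nil => intro s _; simp [iteratedIntegral]
  | cons i w ih =>
    intro s hs
    -- Lebesgue measure is first cut down to `(0, 1]`, since only a finite measure is a signed
    -- measure.
    have hmeas : (stieltjes fun u => X u i).restrict (Ioc s 1) =
        (v i • (volume.restrict (Ioc (0 : ℝ) 1)).toSignedMeasure).restrict (Ioc s 1) := by
      refine restrict_Ioc_eq _ _ fun a b hsa hab hb => ?_
      rw [stieltjes_Ioc (hXv i) ((continuous_apply i).comp hX) hab]
      have h1 := h a ⟨hs.1.trans hsa, hab.trans hb⟩ i
      have h2 := h b ⟨(hs.1.trans hsa).trans hab, hb⟩ i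
      rw [smul_apply, Measure.toSignedMeasure_apply_measurable measurableSet_Ioc,
        measureReal_restrict_apply measurableSet_Ioc,
        inter_eq_left.2 (Ioc_subset_Ioc (hs.1.trans hsa) hb), Real.volume_real_Ioc_of_le hab,
        smul_eq_mul]
      linarith
    simp only [iteratedIntegral]
    rw [hmeas, VectorMeasure.restrict_smul, VectorMeasure.integral_smul_vectorMeasure,
      VectorMeasure.setIntegral_congr_fun (fun u hu => ih ⟨hs.1.trans hu.1.le, hu.2⟩),
      setIntegral_toSignedMeasure_lsmul _ _ measurableSet_Ioc,
      Measure.restrict_restrict measurableSet_Ioc, inter_eq_left.2 (Ioc_subset_Ioc hs.1 le_rfl),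
      ← intervalIntegral.integral_of_le hs.2, intervalIntegral.integral_mul_const,
      intervalIntegral.integral_comp_sub_left (fun u => u ^ w.length), integral_pow]
    simp only [sub_self, List.length_cons, Nat.factorial_succ, List.map_cons, List.prod_cons,
      smul_eq_mul]
    have : (w.length.factorial : ℝ) ≠ 0 := by positivity
    push_cast
    field_simp
    simp

/-- The signature of a linear path is the exponential of its increment. -/
theorem signature_linear {N : ℕ} [Fintype A] (hX : Continuous X) (hXv : BoundedVariationOn X univ)
    (v : A → ℝ) (h : ∀ u ∈ Icc (0 : ℝ) 1, X u - X 0 = u • v) :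
    signature N X 0 1 = TruncTensor.exp (TruncTensor.ofVec v) := by
  refine TruncTensor.ext' fun w => ?_
  rw [TruncTensor.exp_ofVec]
  refine (iteratedIntegral_linear hX (boundedVariationOn_coord hXv) v
    (fun u hu i => congrFun (h u hu) i) w.1 ⟨le_rfl, zero_le_one⟩).trans ?_
  simp

end Linear

/-! ### Physical time as a function of auxiliary time -/

theorem ramp_sub_ramp_le {u v : ℝ} (h : u ≤ v) :
    ramp v - ramp u ≤ v - u := by
  unfold ramp
  rcases max_cases 0 u with ⟨h1, _⟩ | ⟨h1, _⟩ <;> rcases max_cases 0 v with ⟨h2, _⟩ | ⟨h2, _⟩ <;>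
    rcases min_cases 1 (max 0 u) with ⟨h3, _⟩ | ⟨h3, _⟩ <;>
    rcases min_cases 1 (max 0 v) with ⟨h4, _⟩ | ⟨h4, _⟩ <;> linarith

/-- A clock that is stopped during disjoint unit intervals is non-decreasing. -/
theorem monotone_sub_sum_ramp {n : ℕ} (c : Fin n → ℝ) (hc : ∀ i j, i < j → c i + 1 ≤ c j) :
    Monotone fun u => u - ∑ i, ramp (u - c i) := by
  induction n with
  | zero => intro u v h; simpa using h
  | succ n ih =>
    have ih' := ih (fun i => c i.castSucc) fun i j h => hc _ _ (Fin.castSucc_lt_castSucc_iff.2 h)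
    have hlast : ∀ i : Fin n, c i.castSucc + 1 ≤ c (Fin.last n) := fun i =>
      hc _ _ (Fin.castSucc_lt_last i)
    simp only [Fin.sum_univ_castSucc]
    -- Before the last stop its ramp is zero and the induction hypothesis applies. After its start
    -- all earlier ramps equal one, and the only moving ramp is 1-Lipschitz.
    refine MonotoneOn.Iic_union_Ici (a := c (Fin.last n)) ?_ ?_
    · intro u hu v hv h
      have := ih' h
      simp only [mem_Iic] at this hu hv ⊢
      rw [ramp_of_nonpos (u := u - _) (by linarith), ramp_of_nonpos (u := v - _) (by linarith)]
      simpa using this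
    · intro u hu v hv h
      simp only [mem_Ici] at hu hv ⊢
      have h1 : ∀ w, c (Fin.last n) ≤ w → ∑ i : Fin n, ramp (w - c i.castSucc) = n := fun w hw => by
        rw [Finset.sum_congr rfl fun i _ => ramp_of_one_le (by linarith [hlast i])]
        simp
      rw [h1 u hu, h1 v hv]
      have := ramp_sub_ramp_le (sub_le_sub_right h (c (Fin.last n)))
      linarith

/-- A property of the elements of `Fin m` that is inherited by smaller elements is characterised by
a threshold. -/
theorem exists_threshold {m : ℕ} (P : Fin m → Prop) (h : ∀ i j, i ≤ j → P j → P i) :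
    ∃ k ≤ m, ∀ i, P i ↔ i.1 < k := by
  classical
  have hex : ∃ n, ∀ i : Fin m, P i → i.1 < n := ⟨m, fun i _ => i.2⟩
  refine ⟨Nat.find hex, Nat.find_min' hex fun i _ => i.2, fun i => ⟨Nat.find_spec hex i, fun hi => ?_⟩⟩
  have := Nat.find_min hex (m := i.1) hi
  push Not at this
  obtain ⟨j, hj, hij⟩ := this
  exact h i j hij hj

section PhysTime

variable {p : ℕ} {T : ℝ} {O : ObsSet p → Type*} (x : Stream T O)

theorem time_nonneg (i : Fin x.card) : 0 ≤ x.time i := (x.2.2.2 i).1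

theorem time_le (i : Fin x.card) : x.time i ≤ T := (x.2.2.2 i).2

theorem time_strictMono : StrictMono x.time := x.2.2.1

theorem monotone_eventRamp (i : Fin x.card) : Monotone (eventRamp x i) := fun u v h => by
  unfold eventRamp
  exact monotone_ramp (by linarith)

theorem monotone_physTime : Monotone (physTime x) := by
  -- The initial ramp counts as an additional stop, starting at `0`.
  have h := monotone_sub_sum_ramp (n := x.card + 1) (Fin.cons 0 fun i => 1 + x.time i + (i : ℕ)) ?_
  · convert h using 2 with u
    rw [Fin.sum_univ_succ, physTime]
    simp only [Fin.cons_zero, Fin.cons_succ, sub_zero, eventRamp]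
    simp only [sub_sub, add_assoc]
  · intro i j hij
    induction j using Fin.cases with
    | zero => exact absurd hij (Fin.not_lt_zero _)
    | succ j =>
      induction i using Fin.cases with
      | zero =>
        have := time_nonneg x j
        simp only [Fin.cons_zero, Fin.cons_succ]
        have : (0 : ℝ) ≤ (j : ℕ) := Nat.cast_nonneg _
        linarith
      | succ i =>
        have hij' := Fin.succ_lt_succ_iff.1 hij
        have h1 := time_strictMono x hij'
        have h2 : ((i : ℕ) : ℝ) + 1 ≤ (j : ℕ) := by exact_mod_cast Fin.lt_def.1 hij'
        simp only [Fin.cons_succ]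
        linarith

variable {x}

/-- Here `1 + α + j` is the auxiliary time of physical time `α` once `j` events are completed; `i +
1 ≤ j` leaves event `i` the unit of time it needs to finish. -/
theorem eventRamp_eq_one {j : ℕ} {α u : ℝ} (hu : 1 + α + j ≤ u) {i : Fin x.card} (hi : i.1 < j)
    (ht : x.time i ≤ α) : eventRamp x i u = 1 := by
  have : ((i : ℕ) : ℝ) + 1 ≤ j := by exact_mod_cast hi
  exact ramp_of_one_le (by linarith)

theorem eventRamp_eq_zero {j : ℕ} {β u : ℝ} (hu : u ≤ 1 + β + j) {i : Fin x.card} (hi : j ≤ i.1)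
    (ht : β ≤ x.time i) : eventRamp x i u = 0 := by
  have : (j : ℝ) ≤ (i : ℕ) := by exact_mod_cast hi
  exact ramp_of_nonpos (by linarith)

theorem sum_ite_lt {m j : ℕ} (hj : j ≤ m) : ∑ i : Fin m, (if i.1 < j then (1 : ℝ) else 0) = j := by
  rw [Fin.sum_univ_eq_sum_range (fun i => if i < j then (1 : ℝ) else 0) m, Finset.sum_boole]
  congr 1
  have : (Finset.range m).filter (· < j) = Finset.range j := by
    ext i
    simp
    omega
  rw [this, Finset.card_range]

/-- Between two events, physical time runs at unit speed. -/
theorem physTime_gap {j : ℕ} (hj : j ≤ x.card) {α β u : ℝ} (hα : 0 ≤ α) (hu : 1 + α + j ≤ u)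
    (hu' : u ≤ 1 + β + j) (hlo : ∀ i : Fin x.card, i.1 < j → x.time i ≤ α)
    (hhi : ∀ i : Fin x.card, j ≤ i.1 → β ≤ x.time i) : physTime x u = u - 1 - j := by
  have hj0 : (0 : ℝ) ≤ j := Nat.cast_nonneg _
  rw [physTime, ramp_of_one_le (by linarith), ← sum_ite_lt hj]
  congr 1
  refine Finset.sum_congr rfl fun i _ => ?_
  split_ifs with h
  · exact eventRamp_eq_one hu h (hlo i h)
  · exact eventRamp_eq_zero hu' (not_lt.1 h) (hhi i (not_lt.1 h))

variable (x)

theorem eventRamp_of_ne {i j : Fin x.card} (hij : i ≠ j) {u : ℝ} (hu : 1 + x.time j + (j : ℕ) ≤ u)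
    (hu' : u ≤ 1 + x.time j + (j : ℕ) + 1) : eventRamp x i u = if i.1 < j.1 then 1 else 0 := by
  split_ifs with h
  · exact eventRamp_eq_one hu h (time_strictMono x h).le
  · have hji : j < i := lt_of_le_of_ne (not_lt.1 h) hij.symm
    -- The count is `j + 1` because `u` may reach the end of event `j`, by which time that event is
    -- completed.
    refine eventRamp_eq_zero (j := j.1 + 1) (β := x.time j) ?_ hji (time_strictMono x hji).le
    push_cast
    linarith

theorem eventRamp_self {j : Fin x.card} {u : ℝ} (hu : 1 + x.time j + (j : ℕ) ≤ u)
    (hu' : u ≤ 1 + x.time j + (j : ℕ) + 1) :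
    eventRamp x j u = u - (1 + x.time j + (j : ℕ)) := by
  rw [eventRamp, ramp_of_mem ⟨by linarith, by linarith⟩]
  ring

/-- During an event, physical time stands still. -/
theorem physTime_event {j : Fin x.card} {u : ℝ} (hu : 1 + x.time j + (j : ℕ) ≤ u)
    (hu' : u ≤ 1 + x.time j + (j : ℕ) + 1) : physTime x u = x.time j := by
  have hj0 : (0 : ℝ) ≤ (j : ℕ) := Nat.cast_nonneg _
  -- Earlier events contribute one each and later ones zero; the ramp of event `j` cancels the
  -- advance of `u`.
  have hsum : ∑ i, eventRamp x i u = (j : ℕ) + eventRamp x j u := by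
    rw [← sum_ite_lt j.2.le]
    have : eventRamp x j u = ∑ i, if i = j then eventRamp x j u else 0 := by simp
    rw [this, ← Finset.sum_add_distrib]
    refine Finset.sum_congr rfl fun i _ => ?_
    rcases eq_or_ne i j with rfl | hij
    · simp
    · rw [if_neg hij, add_zero, eventRamp_of_ne x hij hu hu']
  rw [physTime, hsum, eventRamp_self x hu hu', ramp_of_one_le (by linarith [time_nonneg x j])]
  ring

theorem eventRamp_before {u : ℝ} (hu : u ≤ 1) (i : Fin x.card) : eventRamp x i u = 0 :=
  eventRamp_eq_zero (j := 0) (β := 0) (by simpa using hu) (Nat.zero_le _) (time_nonneg x i)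

theorem physTime_start {u : ℝ} (hu : u ∈ Icc (0 : ℝ) 1) : physTime x u = 0 := by
  rw [physTime, ramp_of_mem hu, Finset.sum_congr rfl fun i _ => eventRamp_before x hu.2 i]
  simp

theorem physTime_end (hT : 0 ≤ T) : physTime x (T + x.card + 1) = T := by
  rw [physTime_gap (x := x) (j := x.card) le_rfl hT (β := T) (by linarith) (by linarith)
    (fun i _ => time_le x i) fun i hi => absurd i.2 (not_lt.2 hi)]
  ring

theorem physTime_mem (hT : 0 ≤ T) {u : ℝ} (hu : u ∈ Icc (0 : ℝ) (T + x.card + 1)) :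
    physTime x u ∈ Icc 0 T := by
  exact ⟨(physTime_start x ⟨le_rfl, zero_le_one⟩).symm.trans_le (monotone_physTime x hu.1),
    (monotone_physTime x hu.2).trans_eq (physTime_end x hT)⟩

end PhysTime

/-! ### The path realisation on the line -/

section Path

variable {p q N : ℕ} {T : ℝ} {τ : Fin q} {O : ObsSet p → Type*}

theorem lipschitz_embed (p q : ℕ) : LipschitzWith 1 (embed p : (Fin q → ℝ) → Coord p q → ℝ) := by
  refine LipschitzWith.of_dist_le_mul fun a b => ?_
  rw [NNReal.coe_one, one_mul, dist_pi_le_iff dist_nonneg]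
  rintro (i | i | i)
  · simp [embed]
  · simp [embed]
  · exact dist_le_pi_dist a b i

theorem boundedVariationOn_contPart (p : ℕ) (hT : 0 ≤ T) (C : ContPath q T τ) :
    BoundedVariationOn (contPart p hT C) univ :=
  (lipschitz_embed p q).comp_boundedVariationOn (boundedVariationOn_extend hT C.2.1)

theorem boundedVariationOn_ramp : BoundedVariationOn ramp univ :=
  (monotone_ramp.monotoneOn _).boundedVariationOn (C := 1) fun u _ => by
    rw [abs_of_nonneg (ramp_mem u).1]
    exact (ramp_mem u).2

/-- The path realisation, as a path on the line. -/
def linePath (hT : 0 ≤ T) (seg : ∀ s, O s → C(Icc (0 : ℝ) 1, Coord p q → ℝ))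
    (D : ContPath q T τ × Stream T O) (u : ℝ) : Coord p q → ℝ :=
  ramp u • contPart p hT D.1 0 + (contPart p hT D.1 (physTime D.2 u) - contPart p hT D.1 0)
    + ∑ i, seg (D.2.obs i) (D.2.record i) ⟨eventRamp D.2 i u, ramp_mem _⟩

variable (hT : 0 ≤ T) (seg : ∀ s, O s → C(Icc (0 : ℝ) 1, Coord p q → ℝ))
  (D : ContPath q T τ × Stream T O)

theorem continuous_linePath : Continuous (linePath hT seg D) := by
  refine ((continuous_ramp.smul continuous_const).add
    (((continuous_contPart p hT D.1).comp (continuous_physTime D.2)).sub continuous_const)).add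
    (continuous_finsetSum _ fun i _ => ?_)
  exact (seg _ _).continuous.comp ((continuous_eventRamp D.2 i).subtype_mk _)

theorem boundedVariationOn_linePath (h : ∀ s o, BoundedVariationOn (seg s o) univ) :
    BoundedVariationOn (linePath hT seg D) univ := by
  refine boundedVariationOn_add (boundedVariationOn_add ?_ ?_) (boundedVariationOn_sum _ fun i _ => ?_)
  · exact (ContinuousLinearMap.toSpanSingleton ℝ
      (contPart p hT D.1 0)).lipschitz.comp_boundedVariationOn boundedVariationOn_ramp
  · simp only [sub_eq_add_neg]
    exact boundedVariationOn_add (boundedVariationOn_comp_monotone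
      (boundedVariationOn_contPart p hT D.1) ((monotone_physTime D.2).monotoneOn _) (mapsTo_univ _ _))
      (boundedVariationOn_const _)
  · exact boundedVariationOn_comp_monotone (h (D.2.obs i) (D.2.record i))
      (φ := fun u => ⟨eventRamp D.2 i u, ramp_mem _⟩)
      (fun u _ v _ huv => monotone_eventRamp D.2 i huv) (mapsTo_univ _ _)

variable {hT seg D}

/-- All ramps are constant in a gap and cancel from the increment, leaving only the motion of `C̃`
at unit speed. -/
theorem linePath_gap_sub {j : ℕ} (hj : j ≤ D.2.card) {α β u : ℝ} (hα : 0 ≤ α)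
    (hu : u ∈ Icc (1 + α + j) (1 + β + j))
    (hlo : ∀ i : Fin D.2.card, i.1 < j → D.2.time i ≤ α)
    (hhi : ∀ i : Fin D.2.card, j ≤ i.1 → β ≤ D.2.time i) :
    linePath hT seg D u - linePath hT seg D (1 + α + j) =
      contPart p hT D.1 (u - 1 - j) - contPart p hT D.1 α := by
  have hj0 : (0 : ℝ) ≤ j := Nat.cast_nonneg _
  have hs : 1 + α + j ≤ 1 + β + j := hu.1.trans hu.2
  have hr : ∀ i, eventRamp D.2 i u = eventRamp D.2 i (1 + α + j) := fun i => by
    rcases lt_or_ge i.1 j with h | h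
    · rw [eventRamp_eq_one hu.1 h (hlo i h), eventRamp_eq_one le_rfl h (hlo i h)]
    · rw [eventRamp_eq_zero hu.2 h (hhi i h), eventRamp_eq_zero hs h (hhi i h)]
  have hα' : 1 + α + (j : ℝ) - 1 - j = α := by ring
  simp only [linePath, hr]
  rw [physTime_gap hj hα hu.1 hu.2 hlo hhi, physTime_gap hj hα le_rfl hs hlo hhi, hα',
    ramp_of_one_le (by linarith [hu.1]), ramp_of_one_le (by linarith)]
  abel

/-- During event `j` only its own ramp moves, and it starts from zero, where the event path
vanishes. -/
theorem linePath_event_sub (hseg : ∀ s o, seg s o 0 = 0) {j : Fin D.2.card} {u : ℝ}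
    (hu : u ∈ Icc (1 + D.2.time j + (j : ℕ)) (1 + D.2.time j + (j : ℕ) + 1)) :
    linePath hT seg D u - linePath hT seg D (1 + D.2.time j + (j : ℕ)) =
      extend zero_le_one (seg (D.2.obs j) (D.2.record j)) (u - (1 + D.2.time j + (j : ℕ))) := by
  have hj0 : (0 : ℝ) ≤ (j : ℕ) := Nat.cast_nonneg _
  have ht := time_nonneg D.2 j
  have hs : 1 + D.2.time j + (j : ℕ) ≤ 1 + D.2.time j + (j : ℕ) + 1 := by linarith
  simp only [linePath]
  rw [physTime_event D.2 hu.1 hu.2, physTime_event D.2 le_rfl hs,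
    ramp_of_one_le (by linarith [hu.1]), ramp_of_one_le (by linarith), add_sub_add_left_eq_sub,
    ← Finset.sum_sub_distrib, Finset.sum_eq_single j]
  · have h0 : (⟨eventRamp D.2 j (1 + D.2.time j + (j : ℕ)), ramp_mem _⟩ : Icc (0 : ℝ) 1) = 0 :=
      Subtype.ext ((eventRamp_self D.2 le_rfl hs).trans (sub_self _))
    rw [h0, hseg, sub_zero, extend, IccExtend_of_mem _ _ ⟨by linarith [hu.1], by linarith [hu.2]⟩]
    congr 1
    exact Subtype.ext (eventRamp_self D.2 hu.1 hu.2)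
  · intro i _ hij
    have h0 : eventRamp D.2 i u = eventRamp D.2 i (1 + D.2.time j + (j : ℕ)) := by
      rw [eventRamp_of_ne D.2 hij hu.1 hu.2, eventRamp_of_ne D.2 hij le_rfl hs]
    simp only [h0, sub_self]
  · simp

theorem linePath_start (hseg : ∀ s o, seg s o 0 = 0) {u : ℝ} (hu : u ∈ Icc (0 : ℝ) 1) :
    linePath hT seg D u = u • contPart p hT D.1 0 := by
  have h0 : ∀ i, (⟨eventRamp D.2 i u, ramp_mem _⟩ : Icc (0 : ℝ) 1) = 0 :=
    fun i => Subtype.ext (eventRamp_before D.2 hu.2 i)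
  simp only [linePath]
  rw [physTime_start D.2 hu, ramp_of_mem hu,
    Finset.sum_congr rfl fun i _ => (congrArg _ (h0 i)).trans (hseg _ _)]
  simp

theorem linePath_cont (hseg : ∀ s o u (j : Fin q), seg s o u (Coord.cont p j) = 0) (u : ℝ)
    (j : Fin q) : linePath hT seg D u (Coord.cont p j) =
      ramp u * extend hT D.1.1 0 j + (extend hT D.1.1 (physTime D.2 u) j - extend hT D.1.1 0 j) := by
  simp only [linePath, Pi.add_apply, Finset.sum_apply, hseg]
  simp [contPart, embed]

theorem extend_time (C : ContPath q T τ) {t : ℝ} (ht : t ∈ Icc 0 T) : extend hT C.1 t τ = t := by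
  rw [extend, IccExtend_of_mem _ _ ht]
  exact C.2.2 _

/-- The event paths do not touch the time channel, and the initial segment does not either because
`C^τ` vanishes at `0`. -/
theorem linePath_time (hseg : ∀ s o u (j : Fin q), seg s o u (Coord.cont p j) = 0) {u : ℝ}
    (hu : u ∈ Icc (0 : ℝ) (T + D.2.card + 1)) :
    linePath hT seg D u (Coord.cont p τ) = physTime D.2 u := by
  rw [linePath_cont hseg, extend_time D.1 ⟨le_rfl, hT⟩, extend_time D.1 (physTime_mem D.2 hT hu)]
  ring

theorem realisation_apply (u : Icc (0 : ℝ) (T + D.2.card + 1)) :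
    (realisation hT seg D).2 u = linePath hT seg D u := rfl

theorem extend_realisation (h : (0 : ℝ) ≤ T + (realisation hT seg D).1 + 1) {u : ℝ}
    (hu : u ∈ Icc (0 : ℝ) (T + D.2.card + 1)) :
    extend h (realisation hT seg D).2 u = linePath hT seg D u :=
  IccExtend_of_mem _ _ hu

theorem boundedVariationOn_realisation (h : ∀ s o, BoundedVariationOn (seg s o) univ) :
    BoundedVariationOn (realisation hT seg D).2 univ :=
  boundedVariationOn_restrict (boundedVariationOn_linePath hT seg D h) realisation_apply

end Path

/-! ### The interval identity -/

section Interval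

variable {p q N : ℕ} {T : ℝ} {τ : Fin q} {O : ObsSet p → Type*} [∀ s, TopologicalSpace (O s)]
  {inc : ∀ s, O s → TruncLie (Coord p q) N} {seg : ∀ s, O s → C(Icc (0 : ℝ) 1, Coord p q → ℝ)}
  {hT : 0 ≤ T} {D : ContPath q T τ × Stream T O}

theorem signature_linePath_gap (h : IsLocalFactorSystem inc seg) {j : ℕ} (hj : j ≤ D.2.card)
    {α β : ℝ} (hα : 0 ≤ α) (hlo : ∀ i : Fin D.2.card, i.1 < j → D.2.time i ≤ α)
    (hhi : ∀ i : Fin D.2.card, j ≤ i.1 → β ≤ D.2.time i) :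
    signature N (linePath hT seg D) (1 + α + j) (1 + β + j) = gapFactor p N hT D.1 α β := by
  rw [signature_translate (c := -(1 + j)) (continuous_linePath hT seg D)
    (continuous_contPart p hT D.1) (boundedVariationOn_linePath hT seg D h.seg_boundedVariation)
    (boundedVariationOn_contPart p hT D.1), gapFactor]
  · congr 1 <;> ring
  · intro u hu
    rw [linePath_gap_sub hj hα hu hlo hhi]
    congr 2 <;> ring

theorem signature_linePath_event (h : IsLocalFactorSystem inc seg) (j : Fin D.2.card) :
    signature N (linePath hT seg D) (1 + D.2.time j + (j : ℕ)) (1 + D.2.time j + (j : ℕ) + 1) =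
      eventFactor inc D.2 j := by
  rw [signature_translate (c := -(1 + D.2.time j + (j : ℕ))) (continuous_linePath hT seg D)
    ((seg (D.2.obs j) (D.2.record j)).continuous.Icc_extend' (h := zero_le_one))
    (boundedVariationOn_linePath hT seg D h.seg_boundedVariation)
    (boundedVariationOn_extend zero_le_one (h.seg_boundedVariation _ _)), eventFactor,
    ← h.seg_signature]
  · congr 1 <;> ring
  · intro u hu
    have h0 : extend zero_le_one (seg (D.2.obs j) (D.2.record j)) 0 = 0 :=
      (IccExtend_of_mem _ _ ⟨le_rfl, zero_le_one⟩).trans (h.seg_zero _ _)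
    rw [linePath_event_sub h.seg_zero hu, add_neg_cancel]
    change _ = _ - extend zero_le_one (seg (D.2.obs j) (D.2.record j)) 0
    rw [h0, sub_zero, ← sub_eq_add_neg]

theorem signature_linePath_start (h : IsLocalFactorSystem inc seg) :
    signature N (linePath hT seg D) 0 1 =
      TruncTensor.exp (TruncTensor.ofVec (contPart p hT D.1 0)) := by
  refine signature_linear (continuous_linePath hT seg D)
    (boundedVariationOn_linePath hT seg D h.seg_boundedVariation) _ fun u hu => ?_
  rw [linePath_start h.seg_zero hu, linePath_start h.seg_zero ⟨le_rfl, zero_le_one⟩, zero_smul,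
    sub_zero]

/-- The signature of the path realisation across consecutive events is the ordered product of gap
factors and event factors. -/
theorem signature_linePath_eq_factorProduct (h : IsLocalFactorSystem inc seg) {k : ℕ}
    (hk : k ≤ D.2.card) {β : ℝ} (hβ : ∀ i : Fin D.2.card, i.1 < k → D.2.time i ≤ β)
    (hβ' : ∀ i : Fin D.2.card, k ≤ i.1 → β ≤ D.2.time i) (l : List (Fin D.2.card)) :
    l.Pairwise (· < ·) → ∀ {j : ℕ} {α : ℝ}, 0 ≤ α → α ≤ β → j ≤ k →
      (∀ i, i ∈ l ↔ j ≤ i.1 ∧ i.1 < k) →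
      (∀ i : Fin D.2.card, i.1 < j → D.2.time i ≤ α) →
      (∀ i : Fin D.2.card, j ≤ i.1 → i.1 < k → α ≤ D.2.time i) →
      signature N (linePath hT seg D) (1 + α + j) (1 + β + k) =
        factorProduct hT inc D.1 D.2 β l α := by
  induction l with
  | nil =>
    intro _ j α hα _ hjk hmem hlo _
    have hkj : k = j := by
      by_contra hne
      have hlt : j < k := by omega
      simpa using (hmem ⟨j, hlt.trans_le hk⟩).2 ⟨le_rfl, hlt⟩
    subst hkj
    exact signature_linePath_gap h hk hα hlo hβ'
  | cons a l ih =>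
    intro hl j α hα _ hjk hmem hlo hhi
    obtain ⟨hal, hl⟩ := List.pairwise_cons.1 hl
    obtain ⟨hja, hak⟩ := (hmem a).1 (by simp)
    -- Event `j` belongs to the list; were it not the head, it would come after the head and so be
    -- larger.
    have haj : a.1 = j := by
      by_contra hne
      have hlt : j < a.1 := by omega
      have hj := (hmem ⟨j, hlt.trans a.2⟩).2 ⟨le_rfl, hlt.trans hak⟩
      rcases List.mem_cons.1 hj with hj | hj
      · exact hne (congrArg Fin.val hj).symm
      · exact absurd (hal _ hj) (not_lt.2 hja)
    subst haj
    have hαa := hhi a le_rfl hak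
    have haβ := hβ a hak
    have hka : (a.1 : ℝ) + 1 ≤ k := by exact_mod_cast hak
    have ih' := ih hl (j := a.1 + 1) (time_nonneg D.2 a) haβ hak (fun i => by
        constructor
        · intro hi
          exact ⟨hal i hi, ((hmem i).1 (List.mem_cons_of_mem _ hi)).2⟩
        · rintro ⟨h1, h2⟩
          rcases List.mem_cons.1 ((hmem i).2 ⟨by omega, h2⟩) with rfl | hi
          · omega
          · exact hi)
      (fun i hi => (time_strictMono D.2).monotone (Nat.lt_succ_iff.1 hi))
      (fun i hi _ => (time_strictMono D.2).monotone (Nat.le_of_succ_le hi))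
    rw [factorProduct, ← ih', ← signature_linePath_event h a,
      ← signature_linePath_gap h (a.2.le) hα hlo
        (fun i hi => (time_strictMono D.2).monotone hi)]
    -- The end of event `a` is the start of the next gap, with one more event counted.
    have e : 1 + D.2.time a + ((a.1 + 1 : ℕ) : ℝ) = 1 + D.2.time a + (a.1 : ℝ) + 1 := by
      push_cast; ring
    rw [e, signature_mul _ (m := 1 + D.2.time a + (a.1 : ℝ)) (by linarith) (by linarith),
      signature_mul _ (s := 1 + D.2.time a + (a.1 : ℝ)) (m := 1 + D.2.time a + (a.1 : ℝ) + 1)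
        (by linarith) (by linarith), mul_assoc]

/-- Physical time is `0` on all of `[0, 1]`, and the first hitting time is its left end. Intervals
with `α = 0` thus contain the initial segment, the source of `B_C`. -/
theorem startTime_zero (h : IsLocalFactorSystem inc seg) :
    startTime τ (realisation hT seg D) 0 = 0 := by
  have hm : (0 : ℝ) ≤ D.2.card := Nat.cast_nonneg _
  refine IsLeast.csInf_eq ⟨⟨⟨le_rfl, ?_⟩, ?_⟩, fun u hu => hu.choose.1⟩
  · change 0 ≤ T + (D.2.card : ℝ) + 1
    linarith
  · exact (linePath_time h.seg_cont ⟨le_rfl, by linarith⟩).trans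
      (physTime_start D.2 ⟨le_rfl, zero_le_one⟩)

/-- Only events strictly before `α` are counted: an event at `α` starts at this hitting time and
therefore belongs to the interval beginning at `α`. Nothing earlier reaches `α`, since physical time
is monotone and runs at unit speed just before. -/
theorem startTime_of_pos (h : IsLocalFactorSystem inc seg) {α : ℝ} (hα : 0 < α) (hαT : α ≤ T)
    {j : ℕ} (hj : j ≤ D.2.card) (hlt : ∀ i : Fin D.2.card, D.2.time i < α ↔ i.1 < j) :
    startTime τ (realisation hT seg D) α = 1 + α + j := by
  have hj0 : (0 : ℝ) ≤ j := Nat.cast_nonneg _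
  have hjm : (j : ℝ) ≤ D.2.card := by exact_mod_cast hj
  have hdom : 1 + α + j ∈ Icc (0 : ℝ) (T + D.2.card + 1) := ⟨by linarith, by linarith⟩
  have hlo : ∀ i : Fin D.2.card, i.1 < j → D.2.time i ≤ α := fun i hi => ((hlt i).2 hi).le
  have hhi : ∀ i : Fin D.2.card, j ≤ i.1 → α ≤ D.2.time i := fun i hi =>
    not_lt.1 fun hi' => absurd ((hlt i).1 hi') (not_lt.2 hi)
  refine IsLeast.csInf_eq ⟨⟨hdom, ?_⟩, ?_⟩
  · refine ((linePath_time h.seg_cont hdom).trans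
      (physTime_gap hj hα.le le_rfl le_rfl hlo hhi)).trans ?_
    ring
  · rintro u ⟨hu, hval⟩
    have hval' : physTime D.2 u = α := (linePath_time h.seg_cont hu).symm.trans hval
    by_contra hcon
    rw [not_le] at hcon
    -- `α'` is the time of the last event before `α`, or `0` if there is none; between `α'` and `α`
    -- lies a gap.
    obtain ⟨α', hα', hα'α, hlo'⟩ : ∃ α', 0 ≤ α' ∧ α' < α ∧
        ∀ i : Fin D.2.card, i.1 < j → D.2.time i ≤ α' := by
      rcases Nat.eq_zero_or_pos j with rfl | hj1
      · exact ⟨0, le_rfl, hα, fun i hi => absurd hi (Nat.not_lt_zero _)⟩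
      · have hlast : j - 1 < D.2.card := by omega
        refine ⟨D.2.time ⟨j - 1, hlast⟩, time_nonneg _ _, (hlt _).2 (by simp; omega), fun i hi => ?_⟩
        exact (time_strictMono D.2).monotone (Fin.le_def.2 (by simp; omega))
    -- Moving an earlier hitting time `u` forward into this gap gives a point where physical time is
    -- still below `α`, against monotonicity.
    have hle : max u (1 + α' + j) < 1 + α + j := max_lt hcon (by linarith)
    have := monotone_physTime D.2 (le_max_left u (1 + α' + j))
    rw [physTime_gap hj hα' (le_max_right _ _) hle.le hlo' hhi] at this
    linarith

/-- The signature of the path realisation over a physical-time interval is the interval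
signature of the summary. -/
theorem intervalSignature_realisation (h : IsLocalFactorSystem inc seg) {α β : ℝ} (hα : 0 ≤ α)
    (hαβ : α < β) (hβT : β ≤ T) :
    intervalSignature N hT τ (realisation hT seg D) α β = intervalProduct hT inc D α β := by
  have hmono : ∀ i i', i ≤ i' → D.2.time i ≤ D.2.time i' := fun _ _ hi =>
    (time_strictMono D.2).monotone hi
  obtain ⟨j, hj, hjt⟩ := exists_threshold (fun i => D.2.time i < α)
    fun i i' hi h' => (hmono i i' hi).trans_lt h'
  -- The events of the interval are those with index from `j` up to but excluding `k`; for `β = T`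
  -- every event is below the threshold `k`.
  obtain ⟨k, hk, hkt⟩ := exists_threshold (fun i => D.2.time i < β ∨ β = T)
    fun i i' hi h' => h'.imp_left (hmono i i' hi).trans_lt
  have hjk : j ≤ k := by
    by_contra hlt
    rw [not_le] at hlt
    have := (hjt ⟨k, hlt.trans_le hj⟩).2 hlt
    exact lt_irrefl k ((hkt ⟨k, hlt.trans_le hj⟩).1 (Or.inl (this.trans hαβ)))
  have hβlo : ∀ i : Fin D.2.card, i.1 < k → D.2.time i ≤ β := fun i hi => by
    rcases (hkt i).2 hi with h' | rfl
    · exact h'.le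
    · exact time_le D.2 i
  have hβhi : ∀ i : Fin D.2.card, k ≤ i.1 → β ≤ D.2.time i := fun i hi =>
    not_lt.1 fun h' => absurd ((hkt i).1 (Or.inl h')) (not_lt.2 hi)
  have hαlo : ∀ i : Fin D.2.card, i.1 < j → D.2.time i ≤ α := fun i hi => ((hjt i).2 hi).le
  have hαhi : ∀ i : Fin D.2.card, j ≤ i.1 → α ≤ D.2.time i := fun i hi =>
    not_lt.1 fun h' => absurd ((hjt i).1 h') (not_lt.2 hi)
  have hj0 : (0 : ℝ) ≤ j := Nat.cast_nonneg _
  have hkm : (k : ℝ) ≤ D.2.card := by exact_mod_cast hk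
  have hjkR : (j : ℝ) ≤ k := by exact_mod_cast hjk
  have hend : endTime τ (realisation hT seg D) β = 1 + β + k := by
    rw [endTime]
    split_ifs with hβ
    · refine startTime_of_pos h (hα.trans_lt hαβ) hβT hk fun i => ?_
      rw [← hkt i]
      simp [hβ.ne]
    · obtain rfl : β = T := le_antisymm hβT (not_lt.1 hβ)
      have hkc : k = D.2.card := by
        refine le_antisymm hk (not_lt.1 fun hlt => ?_)
        exact lt_irrefl k ((hkt ⟨k, hlt⟩).1 (Or.inr rfl))
      rw [hkc]
      change β + (D.2.card : ℝ) + 1 = _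
      ring
  have hev : factorProduct hT inc D.1 D.2 β (eventsIn D.2 α β) α =
      signature N (linePath hT seg D) (1 + α + j) (1 + β + k) := by
    refine (signature_linePath_eq_factorProduct h hk hβlo hβhi _ ?_ hα hαβ.le hjk ?_ hαlo
      fun i hi _ => hαhi i hi).symm
    · exact (List.pairwise_lt_finRange _).filter _
    · intro i
      simp only [eventsIn, List.mem_filter, List.mem_finRange, true_and, decide_eq_true_eq]
      rw [hkt i, ← not_lt, hjt i, not_lt]
  -- The constant continuation of the realisation and `linePath` may differ outside the domain but
  -- agree on it, so translation invariance with shift `0` identifies the signatures.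
  have hline : ∀ s, s ∈ Icc (0 : ℝ) (1 + β + k) →
      signature N (extend (by positivity) (realisation hT seg D).2) s (1 + β + k) =
        signature N (linePath hT seg D) s (1 + β + k) := fun s hs => by
    have := signature_translate (N := N) (c := 0) (s := s) (t := 1 + β + k)
      (X := extend (by positivity) (realisation hT seg D).2) (Y := linePath hT seg D)
      ((realisation hT seg D).2.continuous.Icc_extend' (h := by positivity))
      (continuous_linePath hT seg D)
      (boundedVariationOn_extend _ (boundedVariationOn_realisation h.seg_boundedVariation))
      (boundedVariationOn_linePath hT seg D h.seg_boundedVariation) fun u hu => ?_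
    · rwa [add_zero, add_zero] at this
    · rw [add_zero, add_zero]
      rw [extend_realisation _ ⟨hs.1.trans hu.1, by linarith [hu.2]⟩,
        extend_realisation _ ⟨hs.1, by linarith [hs.2]⟩]
  rw [intervalSignature, intervalProduct, hend, hev]
  rcases hα.eq_or_lt with rfl | hα
  -- No event precedes time `0`. The signature from auxiliary time `0` splits at `1` into the
  -- initial segment and the rest.
  · have hj' : j = 0 := by
      by_contra hne
      have hj' : 0 < j := Nat.pos_of_ne_zero hne
      exact absurd ((hjt ⟨0, hj'.trans_le hj⟩).2 hj') (not_lt.2 (time_nonneg _ _))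
    subst hj'
    rw [startTime_zero h, hline 0 ⟨le_rfl, by linarith⟩, if_pos rfl, ← signature_linePath_start h,
      signature_mul _ zero_le_one (by linarith)]
    simp
  · rw [startTime_of_pos h hα (hαβ.le.trans hβT) hj hjt, hline _ ⟨by linarith, by linarith⟩,
      if_neg hα.ne', one_mul]

end Interval

/-! ### Continuity -/

section Continuity

variable {p q : ℕ} {T : ℝ} {τ : Fin q} {O : ObsSet p → Type*} [∀ s, TopologicalSpace (O s)]

/-- Continuity on a product with a space of streams can be checked on each event pattern. -/
theorem continuous_of_continuous_pattern {Z W : Type*} [TopologicalSpace Z] [TopologicalSpace W]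
    {f : Z × Stream T O → W}
    (h : ∀ σ : Pattern p, Continuous fun z : Z × StreamOn T O σ => f (z.1, ⟨σ, z.2⟩)) :
    Continuous f := by
  have h1 : Continuous fun z : Stream T O × Z => f (z.2, z.1) := by
    rw [← (Homeomorph.sigmaProdDistrib (X := StreamOn T O) (Y := Z)).symm.comp_continuous_iff']
    exact continuous_sigma fun σ => (h σ).comp continuous_swap
  exact h1.comp continuous_swap

/-- A fixed pattern keeps the values in one component, whose topology is the compact-open one. It is
therefore enough that the formula is jointly continuous in the input and auxiliary time, which uses
joint continuity of evaluation. -/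
theorem continuous_realisation (hT : 0 ≤ T) {seg : ∀ s, O s → C(Icc (0 : ℝ) 1, Coord p q → ℝ)}
    (hseg : ∀ s, Continuous (seg s)) :
    Continuous fun D : ContPath q T τ × Stream T O => realisation hT seg D := by
  refine continuous_of_continuous_pattern fun σ => ?_
  suffices hg : Continuous fun z : ContPath q T τ × StreamOn T O σ =>
      (show C(Icc (0 : ℝ) (T + σ.1 + 1), Coord p q → ℝ) from
        (realisation hT seg (z.1, (⟨σ, z.2⟩ : Stream T O))).2) by
    have hmk := (continuous_sigmaMk
      (σ := fun m : ℕ => C(Icc (0 : ℝ) (T + m + 1), Coord p q → ℝ)) (i := σ.1)).comp hg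
    exact hmk
  refine ContinuousMap.continuous_of_continuous_uncurry _ ?_
  have htime : ∀ i : Fin σ.1, Continuous
      fun z : (ContPath q T τ × StreamOn T O σ) × Icc (0 : ℝ) (T + σ.1 + 1) => z.1.2.1.1 i :=
    fun i => (continuous_apply i).comp
      (continuous_fst.comp (continuous_subtype_val.comp (continuous_snd.comp continuous_fst)))
  have hrec : ∀ i : Fin σ.1, Continuous
      fun z : (ContPath q T τ × StreamOn T O σ) × Icc (0 : ℝ) (T + σ.1 + 1) => z.1.2.1.2 i :=
    fun i => (continuous_apply i).comp
      (continuous_snd.comp (continuous_subtype_val.comp (continuous_snd.comp continuous_fst)))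
  have hu : Continuous
      fun z : (ContPath q T τ × StreamOn T O σ) × Icc (0 : ℝ) (T + σ.1 + 1) => (z.2 : ℝ) :=
    continuous_subtype_val.comp continuous_snd
  have hramp : ∀ i : Fin σ.1, Continuous
      fun z : (ContPath q T τ × StreamOn T O σ) × Icc (0 : ℝ) (T + σ.1 + 1) =>
        eventRamp (O := O) ⟨σ, z.1.2⟩ i z.2 := fun i =>
    continuous_ramp.comp (((hu.sub continuous_const).sub (htime i)).sub
      (continuous_const (y := ((i : ℕ) : ℝ))))
  have hphys : Continuous
      fun z : (ContPath q T τ × StreamOn T O σ) × Icc (0 : ℝ) (T + σ.1 + 1) =>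
        physTime (O := O) ⟨σ, z.1.2⟩ z.2 :=
    (hu.sub (continuous_ramp.comp hu)).sub (continuous_finsetSum Finset.univ fun i _ => hramp i)
  have hcont : ∀ {g : (ContPath q T τ × StreamOn T O σ) × Icc (0 : ℝ) (T + σ.1 + 1) → ℝ},
      Continuous g → Continuous fun z => contPart p hT z.1.1 (g z) := fun hg =>
    (continuous_embed p q).comp
      ((continuous_subtype_val.comp (continuous_fst.comp continuous_fst)).eval
        (continuous_projIcc.comp hg))
  have hsegs : ∀ i : Fin σ.1, Continuous
      fun z : (ContPath q T τ × StreamOn T O σ) × Icc (0 : ℝ) (T + σ.1 + 1) =>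
        seg (σ.2 i) (z.1.2.1.2 i) ⟨eventRamp (O := O) ⟨σ, z.1.2⟩ i z.2, ramp_mem _⟩ := fun i =>
    ((hseg _).comp (hrec i)).eval ((hramp i).subtype_mk _)
  exact (((continuous_ramp.comp hu).smul (hcont continuous_const)).add
    ((hcont hphys).sub (hcont continuous_const))).add
      (continuous_finsetSum Finset.univ fun i _ => hsegs i)

end Continuity

/-! ### Injectivity -/

section Injectivity

variable {p q N : ℕ} {T : ℝ} {τ : Fin q} {O : ObsSet p → Type*}

/-- At the first discrepancy, suppose `t i < t' i` and take `u = 1 + t' i + i`. The ramp of `t i`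
has started, those of `t' k` with `k ≥ i` have not, and earlier ones coincide, so the sums differ.
-/
theorem time_le_of_sum_eventRamp_eq {m : ℕ} {t t' : Fin m → ℝ} (ht' : StrictMono t')
    (hmem : ∀ i, t' i ∈ Icc 0 T)
    (h : ∀ u ∈ Icc (0 : ℝ) (T + m + 1),
      ∑ i : Fin m, ramp (u - 1 - t i - (i : ℕ)) = ∑ i : Fin m, ramp (u - 1 - t' i - (i : ℕ)))
    (i : Fin m) (hi : ∀ k < i, t k = t' k) : t' i ≤ t i := by
  by_contra hcon
  rw [not_le] at hcon
  have hi0 : (0 : ℝ) ≤ (i : ℕ) := Nat.cast_nonneg _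
  have him : ((i : ℕ) : ℝ) ≤ m := by exact_mod_cast i.2.le
  refine absurd (h (1 + t' i + (i : ℕ)) ⟨by linarith [(hmem i).1], by linarith [(hmem i).2]⟩)
    (ne_of_gt (Finset.sum_lt_sum (fun k _ => ?_) ⟨i, Finset.mem_univ _, ?_⟩))
  · rcases lt_or_ge k i with hk | hk
    · rw [hi k hk]
    · have h1 : ((i : ℕ) : ℝ) ≤ (k : ℕ) := by exact_mod_cast hk
      rw [ramp_of_nonpos (u := 1 + t' i + (i : ℕ) - 1 - t' k - (k : ℕ))
        (by linarith [ht'.monotone hk])]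
      exact (ramp_mem _).1
  · rw [ramp_of_nonpos (by linarith), ramp]
    exact lt_min zero_lt_one (lt_max_of_lt_right (by linarith))

theorem eq_of_sum_eventRamp_eq {m : ℕ} {t t' : Fin m → ℝ} (ht : StrictMono t) (ht' : StrictMono t')
    (hmem : ∀ i, t i ∈ Icc 0 T) (hmem' : ∀ i, t' i ∈ Icc 0 T)
    (h : ∀ u ∈ Icc (0 : ℝ) (T + m + 1),
      ∑ i : Fin m, ramp (u - 1 - t i - (i : ℕ)) = ∑ i : Fin m, ramp (u - 1 - t' i - (i : ℕ))) :
    t = t' := by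
  funext i
  induction i using WellFoundedLT.induction with
  | _ i ih =>
    exact le_antisymm
      (time_le_of_sum_eventRamp_eq ht hmem (fun u hu => (h u hu).symm) i fun k hk => (ih k hk).symm)
      (time_le_of_sum_eventRamp_eq ht' hmem' h i ih)

variable [∀ s, TopologicalSpace (O s)] {inc : ∀ s, O s → TruncLie (Coord p q) N}
  {seg : ∀ s, O s → C(Icc (0 : ℝ) 1, Coord p q → ℝ)}

/-- The path of an event determines its observed set. -/
theorem obsSet_eq_of_seg_eq (hN : 1 ≤ N) (h : IsLocalFactorSystem inc seg) {s s' : ObsSet p}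
    {o : O s} {o' : O s'} (heq : seg s o = seg s' o') :
    (inc s o).1 = (inc s' o').1 ∧ s = s' := by
  have h1 : (inc s o).1 = (inc s' o').1 := by
    refine TruncTensor.exp_injOn (TruncTensor.apply_nil_of_mem_truncLie (inc s o).2)
      (TruncTensor.apply_nil_of_mem_truncLie (inc s' o').2) ?_
    rw [← h.seg_signature, ← h.seg_signature, heq]
  refine ⟨h1, Subtype.ext (Finset.ext fun k => ?_)⟩
  -- One-letter words survive the truncation because `N ≥ 1`.
  have h2 := congrFun h1 ⟨[Coord.count q k], hN⟩
  rw [h.inc_count s o _ k rfl, h.inc_count s' o' _ k rfl] at h2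
  by_cases hk : k ∈ s.1 <;> by_cases hk' : k ∈ s'.1 <;> simp [hk, hk'] at h2 ⊢

theorem realisation_injective (hN : 1 ≤ N) (hT : 0 ≤ T) (h : IsLocalFactorSystem inc seg) :
    Function.Injective fun D : ContPath q T τ × Stream T O => realisation hT seg D := by
  rintro ⟨C, ⟨m, s⟩, ⟨⟨t, o⟩, ht⟩⟩ ⟨C', ⟨m', s'⟩, ⟨⟨t', o'⟩, ht'⟩⟩ heq
  obtain rfl : m = m' := congrArg Sigma.fst heq
  have hpath : ∀ u ∈ Icc (0 : ℝ) (T + m + 1),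
      linePath hT seg (C, ⟨⟨m, s⟩, ⟨⟨t, o⟩, ht⟩⟩) u =
        linePath hT seg (C', ⟨⟨m, s'⟩, ⟨⟨t', o'⟩, ht'⟩⟩) u := fun u hu =>
    DFunLike.congr_fun (eq_of_heq (Sigma.mk.inj heq).2) (⟨u, hu⟩ : Icc (0 : ℝ) (T + m + 1))
  obtain rfl : t = t' := by
    refine eq_of_sum_eventRamp_eq ht.1 ht'.1 ht.2 ht'.2 fun u hu => ?_
    have hphys := (linePath_time (D := (C, ⟨⟨m, s⟩, ⟨⟨t, o⟩, ht⟩⟩)) h.seg_cont hu).symm.trans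
      ((congrFun (hpath u hu) (Coord.cont p τ)).trans
        (linePath_time (D := (C', ⟨⟨m, s'⟩, ⟨⟨t', o'⟩, ht'⟩⟩)) h.seg_cont hu))
    exact sub_right_inj.1 hphys
  have hm0 : (0 : ℝ) ≤ m := Nat.cast_nonneg _
  -- The times now agree, so both paths can be compared on the same event intervals.
  have hseg : ∀ i, seg (s i) (o i) = seg (s' i) (o' i) := fun i => by
    have hi0 : (0 : ℝ) ≤ (i : ℕ) := Nat.cast_nonneg _
    have him : ((i : ℕ) : ℝ) + 1 ≤ m := by exact_mod_cast i.2
    have hti := ht.2 i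
    refine ContinuousMap.ext fun r => ?_
    have hr : (1 + t i + (i : ℕ) + r : ℝ) ∈
        Icc (1 + t i + (i : ℕ) : ℝ) (1 + t i + (i : ℕ) + 1) :=
      ⟨by linarith [r.2.1], by linarith [r.2.2]⟩
    have h1 := linePath_event_sub (hT := hT) (D := (C, ⟨⟨m, s⟩, ⟨⟨t, o⟩, ht⟩⟩)) h.seg_zero
      (j := i) hr
    have h2 := linePath_event_sub (hT := hT) (D := (C', ⟨⟨m, s'⟩, ⟨⟨t, o'⟩, ht'⟩⟩)) h.seg_zero
      (j := i) hr
    have h3 := h1.symm.trans ((congrArg₂ (· - ·)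
      (hpath _ ⟨by linarith [hti.1, hr.1], by linarith [hti.2, hr.2]⟩)
      (hpath (1 + t i + (i : ℕ)) ⟨by linarith [hti.1], by linarith [hti.2]⟩)).trans h2)
    dsimp only [Stream.time] at h3
    rw [add_sub_cancel_left, extend, IccExtend_of_mem _ _ r.2, extend,
      IccExtend_of_mem _ _ r.2] at h3
    exact h3
  -- The observed sets are identified first, since only then do the records have a common type.
  obtain rfl : s = s' := funext fun i => (obsSet_eq_of_seg_eq hN h (hseg i)).2
  obtain rfl : o = o' := funext fun i =>
    h.inc_injective _ (Subtype.ext (obsSet_eq_of_seg_eq hN h (hseg i)).1)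
  have hC : C = C' := by
    refine Subtype.ext (ContinuousMap.ext fun r => funext fun k => ?_)
    -- With `j` events before `r`, auxiliary time `1 + r + j` has physical time `r`. The initial
    -- ramp is complete there, so the two copies of `C̃₀` cancel and the continuous channels show `C
    -- r`.
    obtain ⟨j, hj, hjt⟩ := exists_threshold (fun i => t i < r)
      fun i i' hi h' => (ht.1.monotone hi).trans_lt h'
    have hj0 : (0 : ℝ) ≤ j := Nat.cast_nonneg _
    have hjm : (j : ℝ) ≤ m := by exact_mod_cast hj
    have hphys : physTime (T := T) (O := O) ⟨⟨m, s⟩, ⟨⟨t, o⟩, ht⟩⟩ (1 + r + j) = r := by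
      rw [physTime_gap (x := ⟨⟨m, s⟩, ⟨⟨t, o⟩, ht⟩⟩) hj r.2.1 (β := r) le_rfl le_rfl
        (fun i hi => ((hjt i).2 hi).le)
        fun i hi => not_lt.1 fun h' => absurd ((hjt i).1 h') (not_lt.2 hi)]
      ring
    have := (linePath_cont h.seg_cont (1 + r + j) k).symm.trans
      ((congrFun (hpath (1 + r + j) ⟨by linarith [r.2.1], by linarith [r.2.2]⟩)
        (Coord.cont p k)).trans (linePath_cont h.seg_cont (1 + r + j) k))
    dsimp only at this
    rw [hphys, ramp_of_one_le (by linarith [r.2.1])] at this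
    simp only [extend, IccExtend_of_mem _ _ r.2, one_mul, add_sub_cancel] at this
    exact this
  rw [hC]

end Injectivity

/-! ### The default construction -/

section Default

variable {p : ℕ} {T : ℝ}

theorem valueAt_of_mem {s : ObsSet p} (v : Values s) {k : Fin p} (hk : k ∈ s.1) :
    valueAt v k = v ⟨k, hk⟩ := dif_pos hk

theorem continuous_valueAt (s : ObsSet p) (k : Fin p) :
    Continuous fun v : Values s => valueAt v k := by
  unfold valueAt
  split_ifs with h
  · exact continuous_apply _
  · exact continuous_const

theorem continuous_eventVector (q : ℕ) (s : ObsSet p) :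
    Continuous fun v : Values s => eventVector q v := by
  refine continuous_pi fun i => ?_
  rcases i with i | i | i
  · exact continuous_valueAt s i
  · exact continuous_const
  · exact continuous_const

theorem continuous_ofVec {A : Type*} {N : ℕ} :
    Continuous (TruncTensor.ofVec : (A → ℝ) → TruncTensor A N) := by
  refine continuous_pi fun w => ?_
  rcases w with ⟨_ | ⟨i, _ | ⟨j, w⟩⟩, h⟩
  · exact continuous_const
  · exact continuous_apply i
  · exact continuous_const

theorem boundedVariationOn_defaultSeg (p q : ℕ) (s : ObsSet p) (v : Values s) :
    BoundedVariationOn (defaultSeg p q s v) univ := by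
  -- The ramp continues `u` to a bounded monotone function on the whole line.
  refine boundedVariationOn_restrict (f := fun u => ramp u • eventVector q v)
    ((ContinuousLinearMap.toSpanSingleton ℝ
      (eventVector q v)).lipschitz.comp_boundedVariationOn boundedVariationOn_ramp) fun u => ?_
  rw [ramp_of_mem u.2]
  rfl

theorem isLocalFactorSystem_default (p q : ℕ) {N : ℕ} (hN : 1 ≤ N) :
    IsLocalFactorSystem (defaultInc p q N) (defaultSeg p q) where
  inc_continuous s := (continuous_ofVec.comp (continuous_eventVector q s)).subtype_mk _
  inc_injective s v v' h := by
    funext k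
    have h1 := congrFun (Subtype.ext_iff.1 h) ⟨[Coord.value q k.1], hN⟩
    change valueAt v k.1 = valueAt v' k.1 at h1
    rwa [valueAt_of_mem v k.2, valueAt_of_mem v' k.2] at h1
  inc_cont s v w j hj := by
    obtain ⟨_ | ⟨i, _ | ⟨i', w⟩⟩, h⟩ := w
    · rfl
    · obtain rfl : Coord.cont p j = i := by simpa using hj
      rfl
    · rfl
  inc_count s v w k hw := by
    obtain ⟨w, h⟩ := w
    obtain rfl : w = [Coord.count q k] := hw
    rfl
  seg_continuous s := by
    refine ContinuousMap.continuous_of_continuous_uncurry _ ?_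
    exact (continuous_subtype_val.comp continuous_snd).smul
      ((continuous_eventVector q s).comp continuous_fst)
  seg_boundedVariation := boundedVariationOn_defaultSeg p q
  seg_zero s v := zero_smul ℝ _
  seg_cont s v u j := mul_zero _
  seg_signature s v := by
    have hval : ∀ u ∈ Icc (0 : ℝ) 1,
        extend zero_le_one (defaultSeg p q s v) u = u • eventVector q v := fun u hu =>
      IccExtend_of_mem _ _ hu
    refine signature_linear ((defaultSeg p q s v).continuous.Icc_extend' (h := zero_le_one))
      (boundedVariationOn_extend zero_le_one (boundedVariationOn_defaultSeg p q s v)) _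
      fun u hu => ?_
    refine (congrArg₂ (· - ·) (hval u hu) (hval 0 ⟨le_rfl, zero_le_one⟩)).trans ?_
    simp

/-- The index of the previous observation depends only on the pattern, so on a fixed pattern the
subtracted value is either a fixed coordinate of the records or zero. -/
theorem continuous_increments {Z : Type*} [TopologicalSpace Z] :
    Continuous fun D : Z × Stream T (Values (p := p)) => (D.1, increments D.2) := by
  refine continuous_of_continuous_pattern fun σ => continuous_fst.prodMk ?_
  refine (continuous_sigmaMk (σ := StreamOn T (Values (p := p))) (i := σ)).comp
    (f := fun z : Z × StreamOn T (Values (p := p)) σ => (increments ⟨σ, z.2⟩).2) ?_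
  have hrec : ∀ i : Fin σ.1, Continuous
      fun z : Z × StreamOn T (Values (p := p)) σ => z.2.1.2 i := fun i =>
    (continuous_apply i).comp (continuous_snd.comp (continuous_subtype_val.comp continuous_snd))
  have hprev : ∀ (i : Fin σ.1) (k : Fin p), Continuous
      fun z : Z × StreamOn T (Values (p := p)) σ => prevValue ⟨σ, z.2⟩ i k := fun i k => by
    by_cases h : (Finset.univ.filter fun j : Fin σ.1 => j < i ∧ k ∈ (σ.2 j).1).Nonempty
    · exact ((continuous_valueAt _ k).comp (hrec (Finset.max' _ h))).congr fun z =>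
        (dif_pos (t := fun h => valueAt (z.2.1.2 (Finset.max' _ h)) k) h).symm
    · exact continuous_const.congr fun z =>
        (dif_neg (t := fun h => valueAt (z.2.1.2 (Finset.max' _ h)) k) h).symm
  refine continuous_induced_rng.2 ((continuous_fst.comp
    (continuous_subtype_val.comp continuous_snd)).prodMk (continuous_pi fun i => continuous_pi
      fun k => ((continuous_apply k).comp (hrec i)).sub (hprev i k.1)))

/-- Only records strictly before event `i` enter, which makes the passage to increments triangular
in the order of events. -/
theorem prevValue_congr {m : ℕ} {s : Fin m → ObsSet p} {t : Fin m → ℝ}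
    {o o' : ∀ i, Values (s i)} {ht ht'} {i : Fin m} (h : ∀ j < i, o j = o' j) (k : Fin p) :
    prevValue (T := T) ⟨⟨m, s⟩, ⟨(t, o), ht⟩⟩ i k =
      prevValue (T := T) ⟨⟨m, s⟩, ⟨(t, o'), ht'⟩⟩ i k := by
  unfold prevValue
  split_ifs with hne
  · have hmem := Finset.max'_mem _ hne
    simp only [Finset.mem_filter, Finset.mem_univ, true_and] at hmem
    exact congrArg (fun v => valueAt v k) (h _ hmem.1)
  · rfl

/-- Once the earlier records are known, so is the value subtracted at event `i`, and adding it back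
recovers the record. -/
theorem increments_injective :
    Function.Injective (increments : Stream T (Values (p := p)) → Stream T (Values (p := p))) := by
  rintro ⟨⟨m, s⟩, ⟨⟨t, o⟩, ht⟩⟩ ⟨⟨m', s'⟩, ⟨⟨t', o'⟩, ht'⟩⟩ heq
  obtain ⟨h1, h2⟩ := Sigma.mk.inj heq
  obtain ⟨rfl, hs⟩ := Sigma.mk.inj h1
  obtain rfl := eq_of_heq hs
  obtain ⟨ht0, ho⟩ := Prod.mk.inj (Subtype.mk.inj (eq_of_heq h2))
  obtain rfl : t = t' := ht0
  obtain rfl : o = o' := by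
    funext i
    induction i using WellFoundedLT.induction with
    | _ i ih =>
      funext k
      have hk : o i k - prevValue (T := T) ⟨⟨m, s⟩, ⟨(t, o), ht⟩⟩ i k.1 =
          o' i k - prevValue (T := T) ⟨⟨m, s⟩, ⟨(t, o'), ht'⟩⟩ i k.1 := congrFun (congrFun ho i) k
      rw [prevValue_congr (T := T) (t := t) (ht := ht) (ht' := ht') ih k.1] at hk
      exact sub_left_inj.1 hk
  rfl

end Default

/-- Formal faithfulness for local factors: the path realisation is continuous and injective, its
values have bounded variation, and its interval signatures have the interval summaries as
logarithms. -/
theorem formal_faithfulness {p q N : ℕ} (hN : 1 ≤ N) {T : ℝ} (hT : 0 ≤ T) (τ : Fin q)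
    {O : ObsSet p → Type*} [∀ s, TopologicalSpace (O s)] {inc : ∀ s, O s → TruncLie (Coord p q) N}
    {seg : ∀ s, O s → C(Set.Icc (0 : ℝ) 1, Coord p q → ℝ)} (h : IsLocalFactorSystem inc seg) :
    Continuous (fun D : ContPath q T τ × Stream T O => realisation hT seg D) ∧
      Function.Injective (fun D : ContPath q T τ × Stream T O => realisation hT seg D) ∧
      ∀ D : ContPath q T τ × Stream T O,
        BoundedVariationOn (realisation hT seg D).2 Set.univ ∧
        ∀ α β : ℝ, 0 ≤ α → α < β → β ≤ T →
          TruncTensor.log (intervalSignature N hT τ (realisation hT seg D) α β) =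
            intervalSummary hT inc D α β :=
  ⟨continuous_realisation hT h.seg_continuous, realisation_injective hN hT h, fun _ =>
    ⟨boundedVariationOn_realisation h.seg_boundedVariation, fun _ _ hα hαβ hβ =>
      congrArg TruncTensor.log (intervalSignature_realisation h hα hαβ hβ)⟩⟩

end StreamEmbedding

end

/-! ### The proposition for local factors and for raw streams -/

open StreamEmbedding in
theorem mainTheorem2 {p q N : ℕ} (hN : 1 ≤ N) {T : ℝ} (hT : 0 ≤ T) (τ : Fin q) :
    (∀ {O : ObsSet p → Type*} [∀ s, TopologicalSpace (O s)]
        (inc : ∀ s, O s → TruncLie (Coord p q) N)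
        (seg : ∀ s, O s → C(Set.Icc (0 : ℝ) 1, Coord p q → ℝ)),
      IsLocalFactorSystem inc seg →
        Continuous (fun D : ContPath q T τ × Stream T O => realisation hT seg D) ∧
        Function.Injective (fun D : ContPath q T τ × Stream T O => realisation hT seg D) ∧
        ∀ D : ContPath q T τ × Stream T O,
          BoundedVariationOn (realisation hT seg D).2 Set.univ ∧
          ∀ α β : ℝ, 0 ≤ α → α < β → β ≤ T →
            TruncTensor.log (intervalSignature N hT τ (realisation hT seg D) α β) =
              intervalSummary hT inc D α β) ∧
    (Continuous (fun D : ContPath q T τ × Stream T (Values (p := p)) =>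
        realisation hT (defaultSeg p q) (D.1, increments D.2)) ∧
      Function.Injective (fun D : ContPath q T τ × Stream T (Values (p := p)) =>
        realisation hT (defaultSeg p q) (D.1, increments D.2)) ∧
      ∀ D : ContPath q T τ × Stream T (Values (p := p)),
        BoundedVariationOn (realisation hT (defaultSeg p q) (D.1, increments D.2)).2 Set.univ ∧
        ∀ α β : ℝ, 0 ≤ α → α < β → β ≤ T →
          TruncTensor.log
              (intervalSignature N hT τ
                (realisation hT (defaultSeg p q) (D.1, increments D.2)) α β) =
            intervalSummary hT (defaultInc p q N) (D.1, increments D.2) α β) := by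
  refine ⟨fun inc seg h => formal_faithfulness hN hT τ h, ?_⟩
  obtain ⟨h1, h2, h3⟩ := formal_faithfulness (T := T) hN hT τ (isLocalFactorSystem_default p q hN)
  refine ⟨h1.comp continuous_increments, fun D D' h => ?_, fun D => h3 (D.1, increments D.2)⟩
  have h' := Prod.mk.inj (h2 h)
  exact Prod.ext h'.1 (increments_injective h'.2)
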